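/- Let $(T,\Sigma,\mu)$ be a non-atomic $\sigma$-finite measure space. A Musielak--Orlicz function is a map $\Phi:T\times[0,\infty]\to[0,\infty]$ such that $\Phi(\cdot,x)$ is $\mu$-measurable for every $x$ and, for $\mu$-a.e. $t$, $\Phi(t,\cdot)$ is convex and lower semicontinuous, $\Phi(t,0)=\lim_{x\downarrow 0}\Phi(t,x)=0$ and $\Phi(t,\infty)=\infty$. Put $\Phi^*(t,y)=\sup_{x>0}(xy-\Phi(t,x))$ and $\partial\Phi(t,x)=[\Phi'_-(t,x),\Phi'_+(t,x)]$, where $\Phi'_\pm$ are the $[0,\infty]$-valued one-sided derivatives in the second variable (with $\Phi'_-(t,0)=0$). For a ($\mu$-a.e. class of a) measurable $u:T\to\mathbb R$ and $\Psi\in\{\Phi,\Phi^*\}$ let $I_\Psi(u)=\int_T\Psi(t,|u(t)|)\,d\mu$ and $L^\Psi=\{u: I_\Psi(\lambda u)<\infty\text{ for some }\lambda>0\}$. Let $L^\Phi_0$ be $L^\Phi$ with the Orlicz norm $\|u\|_{\Phi,0}=\sup\{|\int_T uv\,d\mu| : I_{\Phi^*}(v)\le 1\}$, and let $\|\cdot\|$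 also denote the norm of its dual $(L^\Phi_0)^*$. For $u\in L^\Phi$ let $K(u)$ be the set of those $k>0$ at which $\inf_{k>0}\frac1k(1+I_\Phi(ku))$ is attained. For $v\in L^{\Phi^*}$ let $f_v(w)=\int_T wv\,d\mu$. A functional $g\in(L_0^\Phi)^*$ is purely singular if its order continuous component is zero, equivalently if $\inf\{\sup_n|g|(w_n):0\le w_n\uparrow w\}=0$ for all $0\le w\in L^\Phi$, where $|g|(w)=\sup\{|g(z)|:|z|\le w\}$. A support functional at $u\ne0$ is an $f\in(L_0^\Phi)^*$ with $\|f\|=1$ and $f(u)=\|u\|_{\Phi,0}$. Proposition. Let $u\in L_0^\Phi\setminus\{0\}$ be such that $K(u)\neq\emptyset$, and let $f=f_v+f_{\mathrm s}\in(L_0^\Phi)^*$ with $v\in L^{\Phi^*}$ and $f_{\mathrm s}$ purely singular. Then $f$ is a support functional at $u$ if and only if, for every $k\in K(u)$, (i) $I_{\Phi^*}(v)+\|f_{\mathrm s}\|=1$; (ii) $\|f_{\mathrm s}\|=f_{\mathrm s}(ku)$; and (iii) for $\mu$-a.e. $t\in T$, $|v(t)|\in\partial\Phi(t,|ku(t)|)$,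 and $\operatorname{sgn}v(t)=\operatorname{sgn}u(t)$ whenever $u(t)\neq0$ and $v(t)\ne0$. If moreover, for $\mu$-a.e. $t$, $\Phi(t,x)>0$ for all $x>0$ and $\Phi'_+(t,0)=0$, then the same equivalence holds with (iii) replaced by: $\operatorname{sgn}v(t)=\operatorname{sgn}u(t)$ and $|v(t)|\in\partial\Phi(t,|ku(t)|)$ for $\mu$-a.e. $t\in T$. -/

import Mathlib

open MeasureTheory Filter Topology Set
open scoped NNReal ENNReal

namespace MusielakOrlicz

/-- A measure is non-atomic if every measurable set of positive measure splits into two measurable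
pieces of positive measure. (Mathlib's `NoAtoms` only says that points have measure zero.) -/
def IsNonatomic {T : Type*} [MeasurableSpace T] (μ : Measure T) : Prop :=
  ∀ A, MeasurableSet A → 0 < μ A →
    ∃ B, MeasurableSet B ∧ B ⊆ A ∧ 0 < μ B ∧ 0 < μ (A \ B)

/-- Musielak--Orlicz functions `Φ : T × [0,∞] → [0,∞]`. -/
structure IsMusielakOrlicz {T : Type*} [MeasurableSpace T] (Φ : T → ℝ≥0∞ → ℝ≥0∞)
    (μ : Measure T) : Prop where
  convex : ∀ᵐ t ∂μ, ConvexOn ℝ≥0 univ (Φ t)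
  lsc : ∀ᵐ t ∂μ, LowerSemicontinuous (Φ t)
  zero : ∀ᵐ t ∂μ, Φ t 0 = 0
  tendsto_zero : ∀ᵐ t ∂μ, Tendsto (Φ t) (𝓝[>] 0) (𝓝 0)
  top : ∀ᵐ t ∂μ, Φ t ∞ = ∞
  measurable : ∀ x, AEMeasurable (fun t => Φ t x) μ

/-- The complementary function `Φ*(t,y) = sup_{x>0} (x y - Φ(t,x))`. The subtraction is truncated
at `0` (and `∞ - ∞ = 0`), which does not change the supremum since it is always nonnegative. -/
noncomputable def complementary {T : Type*} (Φ : T → ℝ≥0∞ → ℝ≥0∞) : T → ℝ≥0∞ → ℝ≥0∞ :=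
  fun t y => ⨆ (x : ℝ≥0∞) (_ : 0 < x), (x * y - Φ t x)

open Classical in
/-- Left derivative of a convex `φ : [0,∞] → [0,∞]`, with values in `[0,∞]`. The difference
quotients are monotone, so the `limsup` is a limit. It is `∞` where `φ = ∞`, and `0` at `x = 0`
(the filter `𝓝[<] 0` is trivial there). -/
noncomputable def leftDeriv (φ : ℝ≥0∞ → ℝ≥0∞) (x : ℝ≥0∞) : ℝ≥0∞ :=
  if φ x = ∞ then ∞ else limsup (fun y => (φ x - φ y) / (x - y)) (𝓝[<] x)

open Classical in
/-- Right derivative of a convex `φ : [0,∞] → [0,∞]`, with values in `[0,∞]`; `∞` where `φ = ∞`. -/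
noncomputable def rightDeriv (φ : ℝ≥0∞ → ℝ≥0∞) (x : ℝ≥0∞) : ℝ≥0∞ :=
  if φ x = ∞ then ∞ else limsup (fun y => (φ y - φ x) / (y - x)) (𝓝[>] x)

/-- `∂φ(x) = [φ'₋(x), φ'₊(x)]`. -/
noncomputable def subdiff (φ : ℝ≥0∞ → ℝ≥0∞) (x : ℝ≥0∞) : Set ℝ≥0∞ :=
  Icc (leftDeriv φ x) (rightDeriv φ x)

section Modular

variable {T : Type*} [MeasurableSpace T]

/-- `I_Ψ(u) = ∫ Ψ(t,|u(t)|) dμ`. -/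
noncomputable def modular (Ψ : T → ℝ≥0∞ → ℝ≥0∞) (μ : Measure T) (u : T →ₘ[μ] ℝ) : ℝ≥0∞ :=
  ∫⁻ t, Ψ t ‖u t‖ₑ ∂μ

/-- The set `L^Ψ` of all `u ∈ L⁰` with `I_Ψ(λu) < ∞` for some `λ > 0`. -/
def orliczSet (Ψ : T → ℝ≥0∞ → ℝ≥0∞) (μ : Measure T) : Set (T →ₘ[μ] ℝ) :=
  {u | ∃ l : ℝ, 0 < l ∧ modular Ψ μ (l • u) < ∞}

variable {Φ : T → ℝ≥0∞ → ℝ≥0∞} {μ : Measure T}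

theorem modular_smul (Ψ : T → ℝ≥0∞ → ℝ≥0∞) (c : ℝ) (u : T →ₘ[μ] ℝ) :
    modular Ψ μ (c • u) = ∫⁻ t, Ψ t (‖c‖ₑ * ‖u t‖ₑ) ∂μ := by
  refine lintegral_congr_ae ?_
  filter_upwards [AEEqFun.coeFn_smul c u] with t ht
  rw [ht, Pi.smul_apply, smul_eq_mul, enorm_mul]

theorem mul_le_of_convex {φ : ℝ≥0∞ → ℝ≥0∞} (hc : ConvexOn ℝ≥0 univ φ) (h0 : φ 0 = 0)
    {a : ℝ≥0} (ha : a ≤ 1) (x : ℝ≥0∞) : φ (a * x) ≤ a * φ x := by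
  have := hc.2 (mem_univ x) (mem_univ 0) (zero_le (a := a)) (zero_le (a := 1 - a))
    (add_tsub_cancel_of_le ha)
  simpa [ENNReal.smul_def, h0] using this

theorem monotone_of_convex {φ : ℝ≥0∞ → ℝ≥0∞} (hc : ConvexOn ℝ≥0 univ φ) (h0 : φ 0 = 0)
    (ht : φ ∞ = ∞) : Monotone φ := by
  intro x y hxy
  rcases eq_or_ne y ∞ with rfl | hy
  · simp [ht]
  rcases eq_or_ne y 0 with rfl | hy0
  · simp_all
  have hx : x ≠ ∞ := ne_top_of_le_ne_top hy hxy
  have hq : x / y ≠ ∞ := ENNReal.div_ne_top hx hy0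
  have h1 : x / y ≤ 1 := ENNReal.div_le_of_le_mul (by simpa using hxy)
  have h1' : (x / y).toNNReal ≤ 1 := by
    rw [← ENNReal.coe_le_coe, ENNReal.coe_toNNReal hq]; simpa using h1
  have := mul_le_of_convex hc h0 h1' y
  rw [ENNReal.coe_toNNReal hq, ENNReal.div_mul_cancel hy0 hy] at this
  exact this.trans (mul_le_of_le_one_left (zero_le) h1)

theorem IsMusielakOrlicz.monotone (h : IsMusielakOrlicz Φ μ) : ∀ᵐ t ∂μ, Monotone (Φ t) := by
  filter_upwards [h.convex, h.zero, h.top] with t h1 h2 h3 using monotone_of_convex h1 h2 h3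

theorem IsMusielakOrlicz.aemeasurable_comp (h : IsMusielakOrlicz Φ μ) {x : T → ℝ≥0∞}
    (hx : AEMeasurable x μ) : AEMeasurable (fun t => Φ t (x t)) μ := by
  obtain ⟨g, hg, hxg⟩ := hx
  have key : (fun t => Φ t (x t)) =ᵐ[μ] fun t => ⨆ q : ℚ,
      {s | ENNReal.ofReal q < g s}.indicator (fun s => Φ s (ENNReal.ofReal q)) t := by
    filter_upwards [h.monotone, h.lsc, h.zero, hxg] with t h1 h2 h3 h4
    rw [h4]
    apply le_antisymm
    · refine le_of_forall_lt fun c hc => ?_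
      have hpos : g t ≠ 0 := by
        intro h0; rw [h0, h3] at hc; exact not_lt_zero hc
      obtain ⟨l, hl, hlg⟩ := exists_Ioc_subset_of_mem_nhds (h2 (g t) c hc)
        ⟨0, pos_iff_ne_zero.2 hpos⟩
      obtain ⟨q, hq0, hlq, hqg⟩ := ENNReal.lt_iff_exists_rat_btwn.1 hl
      have hq' : ENNReal.ofReal q < g t := hqg
      have hc' : c < Φ t (ENNReal.ofReal q) := hlg ⟨hlq, hqg.le⟩
      refine hc'.trans_le (le_iSup_of_le q ?_)
      simp [Set.indicator, hq']
    · refine iSup_le fun q => ?_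
      by_cases hq : ENNReal.ofReal q < g t
      · simpa [Set.indicator, hq] using h1 hq.le
      · simp [Set.indicator, hq]
  refine AEMeasurable.congr (AEMeasurable.iSup fun q => ?_) key.symm
  exact (h.measurable _).indicator (measurableSet_lt measurable_const hg)

theorem IsMusielakOrlicz.aemeasurable_modular (h : IsMusielakOrlicz Φ μ) (c : ℝ)
    (u : T →ₘ[μ] ℝ) : AEMeasurable (fun t => Φ t (‖c‖ₑ * ‖u t‖ₑ)) μ :=
  h.aemeasurable_comp (u.aestronglyMeasurable.enorm.const_mul _)

theorem IsMusielakOrlicz.modular_mono (h : IsMusielakOrlicz Φ μ) {c d : ℝ}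
    (hcd : |c| ≤ |d|) (u : T →ₘ[μ] ℝ) : modular Φ μ (c • u) ≤ modular Φ μ (d • u) := by
  rw [modular_smul, modular_smul]
  refine lintegral_mono_ae ?_
  filter_upwards [h.monotone] with t ht
  apply ht
  gcongr
  rw [← ofReal_norm, ← ofReal_norm]
  exact ENNReal.ofReal_le_ofReal hcd

/-- `L^Φ` is a vector subspace of `L⁰`. -/
def orliczSubmodule (h : IsMusielakOrlicz Φ μ) : Submodule ℝ (T →ₘ[μ] ℝ) where
  carrier := orliczSet Φ μ
  zero_mem' := by
    refine ⟨1, one_pos, ?_⟩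
    rw [modular_smul]
    have : (fun t => Φ t (‖(1 : ℝ)‖ₑ * ‖(0 : T →ₘ[μ] ℝ) t‖ₑ)) =ᵐ[μ] fun _ => 0 := by
      filter_upwards [h.zero, AEEqFun.coeFn_zero (μ := μ) (β := ℝ)] with t h1 h2
      simp [h1, h2]
    rw [lintegral_congr_ae this]; simp
  add_mem' := by
    rintro u w ⟨a, ha, hu⟩ ⟨b, hb, hw⟩
    refine ⟨min a b / 2, by positivity, ?_⟩
    have hm : 0 < min a b := lt_min ha hb
    have hu' : modular Φ μ (min a b • u) < ∞ := (h.modular_mono (by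
      rw [abs_of_pos hm, abs_of_pos ha]; exact min_le_left _ _) u).trans_lt hu
    have hw' : modular Φ μ (min a b • w) < ∞ := (h.modular_mono (by
      rw [abs_of_pos hm, abs_of_pos hb]; exact min_le_right _ _) w).trans_lt hw
    rw [modular_smul] at hu' hw' ⊢
    refine lt_of_le_of_lt ?_ (ENNReal.add_lt_top.2 ⟨hu', hw'⟩)
    rw [← lintegral_add_left' (h.aemeasurable_modular _ _)]
    refine lintegral_mono_ae ?_
    filter_upwards [h.monotone, h.convex, AEEqFun.coeFn_add u w] with t h1 h2 h3
    rw [h3]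
    have hc := h2.2 (mem_univ (‖min a b‖ₑ * ‖u t‖ₑ)) (mem_univ (‖min a b‖ₑ * ‖w t‖ₑ))
      (zero_le (a := (2⁻¹ : ℝ≥0))) (zero_le (a := (2⁻¹ : ℝ≥0)))
      (by rw [← two_mul]; exact mul_inv_cancel₀ two_ne_zero)
    have h2e : ((2⁻¹ : ℝ≥0) : ℝ≥0∞) ≤ 1 := by
      rw [← ENNReal.coe_one, ENNReal.coe_le_coe]; exact inv_le_one_of_one_le₀ one_le_two
    refine (h1 ?_).trans (hc.trans (add_le_add ?_ ?_))
    · rw [div_eq_mul_inv, enorm_mul, ENNReal.smul_def, ENNReal.smul_def, smul_eq_mul, smul_eq_mul,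
        ← mul_add, ← mul_add]
      have : ‖(2⁻¹ : ℝ)‖ₑ = ((2⁻¹ : ℝ≥0) : ℝ≥0∞) := by
        rw [enorm_eq_nnnorm]; congr 1; ext; simp
      rw [this, mul_comm (‖min a b‖ₑ), mul_assoc]
      gcongr
      exact enorm_add_le _ _
    · exact mul_le_of_le_one_left zero_le h2e
    · exact mul_le_of_le_one_left zero_le h2e
  smul_mem' := by
    rintro c u ⟨a, ha, hu⟩
    refine ⟨a / (|c| + 1), by positivity, ?_⟩
    rw [smul_smul]
    refine (h.modular_mono ?_ u).trans_lt hu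
    rw [abs_mul, abs_div, abs_of_pos ha, abs_of_pos (by positivity : 0 < |c| + 1), div_mul_eq_mul_div,
      div_le_iff₀ (by positivity)]
    nlinarith [abs_nonneg c]

/-- Young's inequality. -/
theorem young (Φ : T → ℝ≥0∞ → ℝ≥0∞) (t : T) (x y : ℝ≥0∞) :
    x * y ≤ Φ t x + complementary Φ t y := by
  rcases eq_or_ne x 0 with rfl | hx
  · simp
  rw [← tsub_le_iff_left]
  exact le_iSup₂_of_le (f := fun (x : ℝ≥0∞) (_ : 0 < x) => x * y - Φ t x) x
    (pos_iff_ne_zero.2 hx) le_rfl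

theorem complementary_mul_le (Φ : T → ℝ≥0∞ → ℝ≥0∞) (t : T) {a : ℝ≥0∞} (ha : a ≤ 1) (y : ℝ≥0∞) :
    complementary Φ t (a * y) ≤ a * complementary Φ t y := by
  refine iSup₂_le fun x hx => ?_
  have hat : a ≠ ∞ := ne_top_of_le_ne_top ENNReal.one_ne_top ha
  calc x * (a * y) - Φ t x ≤ a * (x * y) - a * Φ t x := by
        rw [mul_left_comm]
        exact tsub_le_tsub_left (mul_le_of_le_one_left zero_le ha) _
    _ = a * (x * y - Φ t x) := (ENNReal.mul_sub fun _ _ => hat).symm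
    _ ≤ a * complementary Φ t y := by
        gcongr
        exact le_iSup₂_of_le (f := fun (x : ℝ≥0∞) (_ : 0 < x) => x * y - Φ t x) x hx le_rfl

theorem modular_complementary_smul_le (v : T →ₘ[μ] ℝ) {e : ℝ} (he : |e| ≤ 1) :
    modular (complementary Φ) μ (e • v) ≤ ‖e‖ₑ * modular (complementary Φ) μ v := by
  have he' : ‖e‖ₑ ≤ 1 := by
    rw [← ofReal_norm, ← ENNReal.ofReal_one]; exact ENNReal.ofReal_le_ofReal he
  rw [modular_smul, modular, ← lintegral_const_mul' _ _ enorm_ne_top]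
  exact lintegral_mono fun t => complementary_mul_le Φ t he' _

/-- Every element of `L^{Φ*}` has a positive multiple in the unit ball of the modular. -/
theorem exists_modular_smul_le_one {v : T →ₘ[μ] ℝ} (hv : v ∈ orliczSet (complementary Φ) μ) :
    ∃ c : ℝ, 0 < c ∧ modular (complementary Φ) μ (c • v) ≤ 1 := by
  obtain ⟨l, hl, hlv⟩ := hv
  set M := (modular (complementary Φ) μ (l • v)).toReal with hM
  have hM0 : 0 ≤ M := ENNReal.toReal_nonneg
  refine ⟨(M + 1)⁻¹ * l, by positivity, ?_⟩
  have h1 : |(M + 1)⁻¹| ≤ 1 := by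
    rw [abs_of_pos (by positivity)]; exact inv_le_one_of_one_le₀ (by linarith)
  rw [← smul_smul]
  refine (modular_complementary_smul_le _ h1).trans ?_
  rw [← ENNReal.ofReal_toReal hlv.ne, ← hM, ← ofReal_norm, Real.norm_eq_abs,
    abs_of_pos (by positivity), ← ENNReal.ofReal_mul (by positivity), ← ENNReal.ofReal_one]
  apply ENNReal.ofReal_le_ofReal
  rw [inv_mul_le_iff₀ (by positivity)]; linarith

theorem lintegral_mul_le (h : IsMusielakOrlicz Φ μ) (u v : T →ₘ[μ] ℝ) (a : ℝ) :
    ∫⁻ t, ‖a‖ₑ * ‖u t * v t‖ₑ ∂μ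
      ≤ modular Φ μ (a • u) + modular (complementary Φ) μ v := by
  rw [modular_smul, modular, ← lintegral_add_left' (h.aemeasurable_modular _ _)]
  refine lintegral_mono fun t => ?_
  rw [enorm_mul, ← mul_assoc]
  exact young Φ t _ _

theorem integrable_mul_of_modular (h : IsMusielakOrlicz Φ μ) {u v : T →ₘ[μ] ℝ}
    (hu : u ∈ orliczSet Φ μ) (hv : modular (complementary Φ) μ v ≤ 1) :
    Integrable (fun t => u t * v t) μ := by
  obtain ⟨a, ha, hau⟩ := hu
  refine ⟨u.aestronglyMeasurable.mul v.aestronglyMeasurable, ?_⟩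
  have h1 := (lintegral_mul_le h u v a).trans_lt
    (ENNReal.add_lt_top.2 ⟨hau, hv.trans_lt ENNReal.one_lt_top⟩)
  rw [lintegral_const_mul' _ _ enorm_ne_top] at h1
  exact (ENNReal.lt_top_of_mul_ne_top_right h1.ne (by simpa using ha.ne'))

theorem integrable_mul (h : IsMusielakOrlicz Φ μ) {u v : T →ₘ[μ] ℝ}
    (hu : u ∈ orliczSet Φ μ) (hv : v ∈ orliczSet (complementary Φ) μ) :
    Integrable (fun t => u t * v t) μ := by
  obtain ⟨c, hc, hcv⟩ := exists_modular_smul_le_one hv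
  have := (integrable_mul_of_modular h hu hcv).const_mul c⁻¹
  refine this.congr ?_
  filter_upwards [AEEqFun.coeFn_smul c v] with t ht
  rw [ht, Pi.smul_apply, smul_eq_mul]; field_simp

/-- The Orlicz norm `‖u‖_{Φ,0} = sup {|∫ u v dμ| : I_{Φ*}(v) ≤ 1}`. -/
noncomputable def orliczNorm (Φ : T → ℝ≥0∞ → ℝ≥0∞) (μ : Measure T) (u : T →ₘ[μ] ℝ) : ℝ :=
  sSup {r | ∃ v : T →ₘ[μ] ℝ, modular (complementary Φ) μ v ≤ 1 ∧ r = |∫ t, u t * v t ∂μ|}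

theorem orliczNorm_bddAbove (h : IsMusielakOrlicz Φ μ) {u : T →ₘ[μ] ℝ} (hu : u ∈ orliczSet Φ μ) :
    BddAbove {r | ∃ v : T →ₘ[μ] ℝ,
      modular (complementary Φ) μ v ≤ 1 ∧ r = |∫ t, u t * v t ∂μ|} := by
  obtain ⟨a, ha, hau⟩ := hu
  refine ⟨a⁻¹ * ((modular Φ μ (a • u) + 1).toReal), ?_⟩
  rintro r ⟨v, hv, rfl⟩
  have h1 : ∫⁻ t, ‖a‖ₑ * ‖u t * v t‖ₑ ∂μ ≤ modular Φ μ (a • u) + 1 :=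
    (lintegral_mul_le h u v a).trans (by gcongr)
  rw [lintegral_const_mul' _ _ enorm_ne_top] at h1
  have h2 : ‖a‖ₑ * ‖∫ t, u t * v t ∂μ‖ₑ ≤ modular Φ μ (a • u) + 1 :=
    (by gcongr; exact enorm_integral_le_lintegral_enorm _ : _ ≤ _).trans h1
  have h3 := ENNReal.toReal_mono (by finiteness : modular Φ μ (a • u) + 1 ≠ ∞) h2
  rw [ENNReal.toReal_mul, toReal_enorm, toReal_enorm, Real.norm_eq_abs, Real.norm_eq_abs,
    abs_of_pos ha] at h3
  rw [le_inv_mul_iff₀ ha]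
  exact h3

theorem abs_integral_le_orliczNorm (h : IsMusielakOrlicz Φ μ) {u v : T →ₘ[μ] ℝ}
    (hu : u ∈ orliczSet Φ μ) (hv : modular (complementary Φ) μ v ≤ 1) :
    |∫ t, u t * v t ∂μ| ≤ orliczNorm Φ μ u :=
  le_csSup (orliczNorm_bddAbove h hu) ⟨v, hv, rfl⟩

theorem modular_complementary_zero (Φ : T → ℝ≥0∞ → ℝ≥0∞) :
    modular (complementary Φ) μ (0 : T →ₘ[μ] ℝ) ≤ 1 := by
  have : modular (complementary Φ) μ (0 : T →ₘ[μ] ℝ) = 0 := by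
    rw [modular, ← lintegral_zero (μ := μ)]
    refine lintegral_congr_ae ?_
    filter_upwards [AEEqFun.coeFn_zero (μ := μ) (β := ℝ)] with t ht
    simp [ht, complementary]
  rw [this]; exact zero_le

theorem orliczNorm_le {u : T →ₘ[μ] ℝ} {C : ℝ}
    (hC : ∀ v : T →ₘ[μ] ℝ, modular (complementary Φ) μ v ≤ 1 → |∫ t, u t * v t ∂μ| ≤ C) :
    orliczNorm Φ μ u ≤ C := by
  refine csSup_le ⟨_, 0, modular_complementary_zero Φ, rfl⟩ ?_
  rintro r ⟨v, hv, rfl⟩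
  exact hC v hv

theorem orliczNorm_nonneg (u : T →ₘ[μ] ℝ) : 0 ≤ orliczNorm Φ μ u := by
  refine Real.sSup_nonneg ?_
  rintro r ⟨v, hv, rfl⟩
  exact abs_nonneg _

theorem integral_smul_mul (c : ℝ) (u v : T →ₘ[μ] ℝ) :
    ∫ t, (c • u) t * v t ∂μ = c * ∫ t, u t * v t ∂μ := by
  rw [← integral_const_mul]
  refine integral_congr_ae ?_
  filter_upwards [AEEqFun.coeFn_smul c u] with t ht
  rw [ht, Pi.smul_apply, smul_eq_mul, mul_assoc]

theorem integral_mul_smul (c : ℝ) (u v : T →ₘ[μ] ℝ) :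
    ∫ t, u t * (c • v) t ∂μ = c * ∫ t, u t * v t ∂μ := by
  rw [← integral_const_mul]
  refine integral_congr_ae ?_
  filter_upwards [AEEqFun.coeFn_smul c v] with t ht
  rw [ht, Pi.smul_apply, smul_eq_mul]; ring

theorem integral_add_mul {u w v : T →ₘ[μ] ℝ} (hu : Integrable (fun t => u t * v t) μ)
    (hw : Integrable (fun t => w t * v t) μ) :
    ∫ t, (u + w) t * v t ∂μ = ∫ t, u t * v t ∂μ + ∫ t, w t * v t ∂μ := by
  rw [← integral_add hu hw]
  refine integral_congr_ae ?_
  filter_upwards [AEEqFun.coeFn_add u w] with t ht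
  rw [ht, Pi.add_apply, add_mul]

theorem orliczNorm_smul_le (h : IsMusielakOrlicz Φ μ) (c : ℝ) {u : T →ₘ[μ] ℝ}
    (hu : u ∈ orliczSet Φ μ) : orliczNorm Φ μ (c • u) ≤ |c| * orliczNorm Φ μ u := by
  refine orliczNorm_le fun v hv => ?_
  rw [integral_smul_mul, abs_mul]
  exact mul_le_mul_of_nonneg_left (abs_integral_le_orliczNorm h hu hv) (abs_nonneg c)

theorem orliczNorm_smul (h : IsMusielakOrlicz Φ μ) (c : ℝ) {u : T →ₘ[μ] ℝ}
    (hu : u ∈ orliczSet Φ μ) : orliczNorm Φ μ (c • u) = |c| * orliczNorm Φ μ u := by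
  refine le_antisymm (orliczNorm_smul_le h c hu) ?_
  rcases eq_or_ne c 0 with rfl | hc
  · simpa using orliczNorm_nonneg _
  have := orliczNorm_smul_le h c⁻¹ ((orliczSubmodule h).smul_mem c hu)
  rw [smul_smul, inv_mul_cancel₀ hc, one_smul, abs_inv] at this
  rwa [← le_inv_mul_iff₀ (abs_pos.2 hc)]

theorem orliczNorm_add_le (h : IsMusielakOrlicz Φ μ) {u w : T →ₘ[μ] ℝ}
    (hu : u ∈ orliczSet Φ μ) (hw : w ∈ orliczSet Φ μ) :
    orliczNorm Φ μ (u + w) ≤ orliczNorm Φ μ u + orliczNorm Φ μ w := by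
  refine orliczNorm_le fun v hv => ?_
  rw [integral_add_mul (integrable_mul_of_modular h hu hv) (integrable_mul_of_modular h hw hv)]
  exact (abs_add_le _ _).trans (add_le_add (abs_integral_le_orliczNorm h hu hv)
    (abs_integral_le_orliczNorm h hw hv))

theorem IsMusielakOrlicz.exists_nat (h : IsMusielakOrlicz Φ μ) :
    ∀ᵐ t ∂μ, ∃ n : ℕ, 0 < n ∧ 1 < Φ t n := by
  filter_upwards [h.lsc, h.top] with t h1 h2
  have h3 : ∀ᶠ y in 𝓝 ∞, 1 < Φ t y :=
    h1 ∞ 1 (show 1 < Φ t ∞ by rw [h2]; exact ENNReal.one_lt_top)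
  have h4 := (ENNReal.tendsto_nat_nhds_top.eventually h3).and (eventually_gt_atTop 0)
  obtain ⟨n, hn1, hn2⟩ := h4.exists
  exact ⟨n, hn2, hn1⟩

theorem complementary_inv_le_one {φ : T → ℝ≥0∞ → ℝ≥0∞} {t : T} (hc : ConvexOn ℝ≥0 univ (φ t))
    (h0 : φ t 0 = 0) (ht : φ t ∞ = ∞) {n : ℕ} (hn : 0 < n) (h1 : 1 < φ t n) :
    complementary φ t (n : ℝ≥0∞)⁻¹ ≤ 1 := by
  have hn0 : (n : ℝ≥0∞) ≠ 0 := by exact_mod_cast hn.ne'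
  have hnt : (n : ℝ≥0∞) ≠ ∞ := ENNReal.natCast_ne_top n
  refine iSup₂_le fun x hx => ?_
  rw [← div_eq_mul_inv]
  rcases le_total x n with hxn | hxn
  · exact tsub_le_self.trans (ENNReal.div_le_of_le_mul (by simpa using hxn))
  · rcases eq_or_ne x ∞ with rfl | hxt
    · simp [ht]
    have hq : (n : ℝ≥0∞) / x ≠ ∞ := ENNReal.div_ne_top hnt hx.ne'
    have hq1 : ((n : ℝ≥0∞) / x).toNNReal ≤ 1 := by
      rw [← ENNReal.coe_le_coe, ENNReal.coe_toNNReal hq]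
      exact ENNReal.div_le_of_le_mul (by simpa using hxn)
    have h2 := mul_le_of_convex hc h0 hq1 x
    rw [ENNReal.coe_toNNReal hq, ENNReal.div_mul_cancel hx.ne' hxt] at h2
    have h3 : x / n ≤ φ t x := by
      calc x / n ≤ x / n * (n / x * φ t x) := le_mul_of_one_le_right zero_le (h1.le.trans h2)
        _ = φ t x := by
          rw [← mul_assoc, div_eq_mul_inv, div_eq_mul_inv, mul_assoc x, ← mul_assoc _⁻¹,
            ENNReal.inv_mul_cancel hn0 hnt, one_mul, ENNReal.mul_inv_cancel hx.ne' hxt, one_mul]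
    rw [tsub_eq_zero_of_le h3]; exact zero_le

theorem eq_zero_of_orliczNorm_eq_zero [SigmaFinite μ] (h : IsMusielakOrlicz Φ μ) {u : T →ₘ[μ] ℝ}
    (hu : u ∈ orliczSet Φ μ) (h0 : orliczNorm Φ μ u = 0) : u = 0 := by
  set g : ℕ → T → ℝ≥0∞ := fun n => (h.measurable (n : ℝ≥0∞)).mk _ with hg
  have hgm : ∀ n, Measurable (g n) := fun n => (h.measurable (n : ℝ≥0∞)).measurable_mk
  have hge : ∀ᵐ t ∂μ, ∀ n : ℕ, Φ t n = g n t :=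
    ae_all_iff.2 fun n => (h.measurable (n : ℝ≥0∞)).ae_eq_mk
  have key : ∀ n k : ℕ, 0 < n → ∀ᵐ t ∂μ, t ∈ {t | 1 < g n t} ∩ spanningSets μ k → u t = 0 := by
    intro n k hn
    set A := {t | 1 < g n t} ∩ spanningSets μ k with hA
    have hAm : MeasurableSet A :=
      (measurableSet_lt measurable_const (hgm n)).inter (measurableSet_spanningSets μ k)
    have hAfin : μ A < ∞ := (measure_mono inter_subset_right).trans_lt
      (measure_spanningSets_lt_top μ k)
    set w : T → ℝ := A.indicator fun t => (n : ℝ)⁻¹ * Real.sign (u t) with hw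
    have hsm : Measurable Real.sign := by
      unfold Real.sign
      exact Measurable.ite measurableSet_Iio measurable_const
        (Measurable.ite measurableSet_Ioi measurable_const measurable_const)
    have hwm : AEStronglyMeasurable w μ :=
      ((hsm.comp u.measurable).const_mul _ |>.indicator hAm).aestronglyMeasurable
    have hwmem : AEEqFun.mk w hwm ∈ orliczSet (complementary Φ) μ := by
      refine ⟨1, one_pos, ?_⟩
      rw [one_smul, modular]
      refine lt_of_le_of_lt (lintegral_mono_ae (g := A.indicator 1) ?_) ?_
      · filter_upwards [AEEqFun.coeFn_mk w hwm, hge, h.convex, h.zero, h.top]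
          with t h1 h2 h3 h4 h5
        rw [h1, hw]
        by_cases htA : t ∈ A
        · have hgt : 1 < Φ t n := by rw [h2 n]; exact htA.1
          have hle : ‖Real.sign (u t)‖ₑ ≤ 1 := by
            rw [← ofReal_norm, ← ENNReal.ofReal_one]
            apply ENNReal.ofReal_le_ofReal
            rcases Real.sign_apply_eq (u t) with h | h | h <;> simp [h]
          have hni : ‖(n : ℝ)⁻¹‖ₑ = (n : ℝ≥0∞)⁻¹ := by
            rw [enorm_inv (by exact_mod_cast hn.ne')]; simp
          rw [Set.indicator_of_mem htA, Set.indicator_of_mem htA, enorm_mul, mul_comm, hni]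
          refine (complementary_mul_le Φ t hle _).trans ?_
          exact (mul_le_of_le_one_left zero_le hle).trans
            (complementary_inv_le_one h3 h4 h5 hn hgt)
        · simp [htA, complementary]
      · rw [lintegral_indicator_one hAm]; exact hAfin
    obtain ⟨c, hc, hcw⟩ := exists_modular_smul_le_one hwmem
    have h1 := abs_integral_le_orliczNorm h hu hcw
    rw [h0, integral_mul_smul] at h1
    have h2 : ∫ t, u t * (AEEqFun.mk w hwm) t ∂μ = 0 := by
      have := abs_nonpos_iff.1 h1
      exact (mul_eq_zero.1 this).resolve_left hc.ne'
    have hpt : ∀ᵐ t ∂μ, u t * (AEEqFun.mk w hwm) t = A.indicator (fun t => (n : ℝ)⁻¹ * |u t|) t := by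
      filter_upwards [AEEqFun.coeFn_mk w hwm] with t h1
      rw [h1, hw]
      by_cases htA : t ∈ A
      · rw [Set.indicator_of_mem htA, Set.indicator_of_mem htA]
        rcases lt_trichotomy (u t) 0 with hs | hs | hs
        · rw [Real.sign_of_neg hs, abs_of_neg hs]; ring
        · simp [hs]
        · rw [Real.sign_of_pos hs, abs_of_pos hs]; ring
      · simp [htA]
    have h3 := (integral_eq_zero_iff_of_nonneg_ae (by
      filter_upwards [hpt] with t ht
      rw [ht]
      exact Set.indicator_nonneg (fun _ _ => by positivity) t)
      (integrable_mul h hu hwmem)).1 h2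
    filter_upwards [h3, hpt] with t h4 h5 htA
    rw [h5, Set.indicator_of_mem htA] at h4
    have hn' : (n : ℝ)⁻¹ ≠ 0 := by positivity
    simpa [hn'] using h4
  have key' : ∀ᵐ t ∂μ, ∀ n k : ℕ, 0 < n →
      t ∈ {t | 1 < g n t} ∩ spanningSets μ k → u t = 0 := by
    refine ae_all_iff.2 fun n => ae_all_iff.2 fun k => ?_
    by_cases hn : 0 < n
    · filter_upwards [key n k hn] with t ht _ using ht
    · exact Eventually.of_forall fun t h => absurd h hn
  refine AEEqFun.ext ?_
  filter_upwards [key', hge, h.exists_nat, AEEqFun.coeFn_zero (μ := μ) (β := ℝ)] with t h1 h2 h3 h4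
  obtain ⟨n, hn, hn1⟩ := h3
  rw [h4]
  refine h1 n (spanningSetsIndex μ t) hn ⟨?_, mem_spanningSetsIndex μ t⟩
  rw [Set.mem_ofPred_eq, ← h2 n]; exact hn1

end Modular

section Space

variable {T : Type*} [MeasurableSpace T] {Φ : T → ℝ≥0∞ → ℝ≥0∞} {μ : Measure T}

/-- The space `L₀^Φ`, i.e. the vector space `L^Φ` equipped with the Orlicz norm. -/
def OrliczSpace (h : IsMusielakOrlicz Φ μ) : Type _ := ↥(orliczSubmodule h)

namespace OrliczSpace

variable {h : IsMusielakOrlicz Φ μ}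

/-- The underlying class of measurable functions of an element of `L₀^Φ`. -/
def toL0 (u : OrliczSpace h) : T →ₘ[μ] ℝ := Subtype.val u

theorem toL0_mem (u : OrliczSpace h) : u.toL0 ∈ orliczSet Φ μ := Subtype.property u

instance instAddCommGroup : AddCommGroup (OrliczSpace h) :=
  inferInstanceAs (AddCommGroup ↥(orliczSubmodule h))

instance instModule : Module ℝ (OrliczSpace h) :=
  inferInstanceAs (Module ℝ ↥(orliczSubmodule h))

theorem toL0_add (u w : OrliczSpace h) : (u + w).toL0 = u.toL0 + w.toL0 := rfl

theorem toL0_smul (c : ℝ) (u : OrliczSpace h) : (c • u).toL0 = c • u.toL0 := rfl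

noncomputable instance instNorm : Norm (OrliczSpace h) := ⟨fun u => orliczNorm Φ μ u.toL0⟩

theorem norm_def (u : OrliczSpace h) : ‖u‖ = orliczNorm Φ μ u.toL0 := rfl

theorem core [SigmaFinite μ] : NormedSpace.Core ℝ (OrliczSpace h) where
  norm_nonneg u := orliczNorm_nonneg u.toL0
  norm_smul c u := orliczNorm_smul h c u.toL0_mem
  norm_triangle u w := orliczNorm_add_le h u.toL0_mem w.toL0_mem
  norm_eq_zero_iff u := by
    constructor
    · intro h0
      exact Subtype.ext (eq_zero_of_orliczNorm_eq_zero h u.toL0_mem h0)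
    · rintro rfl
      have := orliczNorm_smul h 0 (u := (0 : OrliczSpace h).toL0) (toL0_mem _)
      rwa [abs_zero, zero_mul, ← toL0_smul, zero_smul] at this

noncomputable instance instNormedAddCommGroup [SigmaFinite μ] :
    NormedAddCommGroup (OrliczSpace h) :=
  NormedAddCommGroup.ofCore core

noncomputable instance instNormedSpace [SigmaFinite μ] : NormedSpace ℝ (OrliczSpace h) :=
  NormedSpace.ofCore core

end OrliczSpace

/-- The order continuous functional `f_v(u) = ∫ u v dμ` on `L₀^Φ`, for `v ∈ L^{Φ*}`. -/
noncomputable def ordContFunctional [SigmaFinite μ] (h : IsMusielakOrlicz Φ μ) (v : T →ₘ[μ] ℝ)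
    (hv : v ∈ orliczSet (complementary Φ) μ) : StrongDual ℝ (OrliczSpace h) :=
  LinearMap.mkContinuousOfExistsBound
    { toFun := fun u => ∫ t, u.toL0 t * v t ∂μ
      map_add' := fun u w => integral_add_mul (integrable_mul h u.toL0_mem hv)
        (integrable_mul h w.toL0_mem hv)
      map_smul' := fun c u => integral_smul_mul c u.toL0 v }
    (by
      obtain ⟨c, hc, hcv⟩ := exists_modular_smul_le_one hv
      refine ⟨c⁻¹, fun u => ?_⟩
      have h1 := abs_integral_le_orliczNorm h u.toL0_mem hcv
      rw [integral_mul_smul, abs_mul, abs_of_pos hc, ← le_inv_mul_iff₀ hc] at h1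
      exact h1)

/-- The absolute value `|f|(u) = sup {|f(w)| : |w| ≤ u}` of a functional, at `u ≥ 0`. -/
noncomputable def absFunctional [SigmaFinite μ] {h : IsMusielakOrlicz Φ μ}
    (f : StrongDual ℝ (OrliczSpace h)) (u : OrliczSpace h) : ℝ≥0∞ :=
  ⨆ (w : OrliczSpace h) (_ : |w.toL0| ≤ u.toL0), ‖f w‖ₑ

/-- The order continuous component of the positive functional `|f|`, at `u ≥ 0`:
`|f|_c(u) = inf {sup_n |f|(u_n) : 0 ≤ u_n ↑ u}`. -/
noncomputable def absOrdContPart [SigmaFinite μ] {h : IsMusielakOrlicz Φ μ}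
    (f : StrongDual ℝ (OrliczSpace h)) (u : OrliczSpace h) : ℝ≥0∞ :=
  ⨅ (x : ℕ → OrliczSpace h) (_ : ∀ n, 0 ≤ (x n).toL0)
    (_ : Monotone fun n => (x n).toL0)
    (_ : ∀ᵐ t ∂μ, Tendsto (fun n => (x n).toL0 t) atTop (𝓝 (u.toL0 t))),
    ⨆ n, absFunctional f (x n)

/-- `f` is purely singular: its order continuous component vanishes, i.e. `|f|_c = |f_c| = 0`. -/
def IsPurelySingular [SigmaFinite μ] {h : IsMusielakOrlicz Φ μ}
    (f : StrongDual ℝ (OrliczSpace h)) : Prop :=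
  ∀ u : OrliczSpace h, 0 ≤ u.toL0 → absOrdContPart f u = 0

/-- The Amemiya expression `k⁻¹ (1 + I_Φ(k u))`. -/
noncomputable def amemiya {h : IsMusielakOrlicz Φ μ} (u : OrliczSpace h) (k : ℝ) : ℝ≥0∞ :=
  (ENNReal.ofReal k)⁻¹ * (1 + modular Φ μ (k • u.toL0))

/-- `K(u)`: the set of all `k > 0` at which `inf_{k>0} k⁻¹ (1 + I_Φ(k u))` is attained. -/
def minimizers {h : IsMusielakOrlicz Φ μ} (u : OrliczSpace h) : Set ℝ :=
  {k | 0 < k ∧ amemiya u k = ⨅ (l : ℝ) (_ : 0 < l), amemiya u l}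

end Space

/-- `f` is a support functional at `x`: `f` has norm one and `f x = ‖x‖`. -/
def IsSupportFunctional {X : Type*} [NormedAddCommGroup X] [NormedSpace ℝ X]
    (f : StrongDual ℝ X) (x : X) : Prop :=
  ‖f‖ = 1 ∧ f x = ‖x‖

end MusielakOrlicz

/-! Fix `k ∈ K(u)`. Amemiya's formula gives `k‖u‖ = 1 + I_Φ(ku)`. On the other side `k f(u) = ∫ ku·v
+ f_s(ku)`, and three inequalities bound this: Young's inequality gives `∫ ku·v ≤ I_Φ(ku) +
I_{Φ*}(v)`; a purely singular functional satisfies `f_s(ku) ≤ ‖f_s‖`, because `I_Φ(ku) < ∞`; and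
`‖f‖ ≤ 1` is equivalent to `I_{Φ*}(v) + ‖f_s‖ ≤ 1`. Hence `f(u) = ‖u‖` together with `‖f‖ ≤ 1` means
equality in all three, which is (ii), (iii) and (i); equality in Young's inequality is the pointwise
subdifferential condition with matching signs. As `u ≠ 0`, the bound `‖f‖ ≥ 1` is then automatic.
The argument works with any single minimizer, so nonemptiness of `K(u)` is all that the quantifier
over `k` requires (`isSupportFunctional_iff`).

Two facts carry the proof. The hard half of Amemiya's formula (`exists_one_add_modular_le`) comes
from a Lagrange multiplier for maximising `∫ |w| y` under `I_{Φ*}(y) ≤ 1`, combined with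
biconjugation and an exchange of supremum and integral by measurable selection.

The description of the dual unit ball is `norm_add_le_one` and `modular_add_norm_le_one`. Up to a
part on which it is small, a purely singular functional sees only functions `y_n` that tend to zero
almost everywhere. Such `y_n`, when dominated in modular, have `I_Φ(y_n) → 0`, whence `|f_s| ≤
‖f_s‖` on the domain of the modular. Conversely, a near-maximiser for `I_{Φ*}(v)` can be glued to
such a `y_n` that nearly norms `f_s`, with a vanishing change of integral and modular. -/

namespace MusielakOrlicz

/-! ### Countable families of arguments. -/

/-- A dense sequence of nonnegative reals that starts with `0`. -/
noncomputable def nnrealSeq : ℕ → ℝ≥0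
  | 0 => 0
  | n + 1 => TopologicalSpace.denseSeq ℝ≥0 n

theorem exists_nnrealSeq_mem {s : Set ℝ≥0} (ho : IsOpen s) (hs : s.Nonempty) :
    ∃ n, nnrealSeq n ∈ s := by
  obtain ⟨n, hn⟩ := (TopologicalSpace.denseRange_denseSeq ℝ≥0).exists_mem_open ho hs
  exact ⟨n + 1, hn⟩

/-- The approximation is from the left because `Φ t` may jump to `∞`: moving an argument down never
increases a monotone function. -/
theorem exists_nnrealSeq_lt_of_isOpen {s : Set ℝ≥0} (ho : IsOpen s) {x : ℝ≥0} (hx : x ∈ s)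
    (hx0 : 0 < x) : ∃ n, nnrealSeq n ∈ s ∧ nnrealSeq n < x := by
  have : (𝓝[<] x).NeBot := nhdsLT_neBot_of_exists_lt ⟨0, hx0⟩
  have h1 : ∀ᶠ y in 𝓝[<] x, y ∈ s ∧ y < x :=
    Filter.Eventually.and (mem_nhdsWithin_of_mem_nhds (ho.mem_nhds hx)) self_mem_nhdsWithin
  exact exists_nnrealSeq_mem (s := s ∩ Iio x) (ho.inter isOpen_Iio) h1.exists

/-! ### Convex duality in one variable. -/

section Pointwise

variable {T : Type*} [MeasurableSpace T] {Φ : T → ℝ≥0∞ → ℝ≥0∞} {t : T}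

/-- Since `x * y` is continuous in finite `x` and `Φ t` does not increase to the left, a nearby
smaller point of the sequence does as well as `x`. A countable supremum is what measurability and
selection need. -/
theorem complementary_eq_iSup_nnrealSeq (hm : Monotone (Φ t)) (ht : Φ t ∞ = ∞)
    {y : ℝ≥0∞} (hy : y ≠ ∞) :
    complementary Φ t y = ⨆ n, (nnrealSeq n * y - Φ t (nnrealSeq n)) := by
  apply le_antisymm
  · refine iSup₂_le fun x hx => le_of_forall_lt fun c hc => ?_
    rcases eq_or_ne x ∞ with rfl | hxt
    · simp [ht] at hc
    lift x to ℝ≥0 using hxt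
    have hcont : Continuous fun z : ℝ≥0 => (z : ℝ≥0∞) * y - Φ t x :=
      (ENNReal.continuous_sub_right _).comp
        ((ENNReal.continuous_mul_const hy).comp ENNReal.continuous_coe)
    obtain ⟨n, h1, h2⟩ := exists_nnrealSeq_lt_of_isOpen (isOpen_Ioi.preimage hcont)
      (show x ∈ _ ⁻¹' Ioi c from hc)
      (by exact_mod_cast hx)
    refine lt_of_lt_of_le (show c < _ from h1) (le_iSup_of_le n ?_)
    exact tsub_le_tsub_left (hm (by exact_mod_cast h2.le)) _
  · refine iSup_le fun n => ?_
    rw [tsub_le_iff_left]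
    exact young Φ t _ _

omit [MeasurableSpace T] in
theorem complementary_mono : Monotone (complementary Φ t) := by
  intro y z hyz
  exact iSup₂_mono fun x _ => tsub_le_tsub_right (by gcongr) _

omit [MeasurableSpace T] in
theorem complementary_zero : complementary Φ t 0 = 0 := by simp [complementary]

theorem complementary_convex_comb {a b : ℝ≥0∞} (hab : a + b = 1) (y z : ℝ≥0∞) :
    complementary Φ t (a * y + b * z) ≤ a * complementary Φ t y + b * complementary Φ t z := by
  refine iSup₂_le fun x hx => ?_
  rw [tsub_le_iff_left]
  calc (x : ℝ≥0∞) * (a * y + b * z) = a * (x * y) + b * (x * z) := by ring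
    _ ≤ a * (Φ t x + complementary Φ t y) + b * (Φ t x + complementary Φ t z) := by
      gcongr <;> exact young Φ t _ _
    _ = (a + b) * Φ t x + (a * complementary Φ t y + b * complementary Φ t z) := by ring
    _ = _ := by rw [hab, one_mul]

/-- Convexity in the form without division. -/
theorem convex_three_points {φ : ℝ≥0∞ → ℝ≥0∞} (hc : ConvexOn ℝ≥0 univ φ) {x y z : ℝ≥0}
    (hxy : x < y) (hyz : y < z) :
    ((z - x : ℝ≥0) : ℝ≥0∞) * φ y ≤ ((z - y : ℝ≥0) : ℝ≥0∞) * φ x + ((y - x : ℝ≥0) : ℝ≥0∞) * φ z := by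
  have hxz := hxy.trans hyz
  have hpos : 0 < z - x := tsub_pos_of_lt hxz
  have hsum : (z - y) + (y - x) = z - x := tsub_add_tsub_cancel hyz.le hxy.le
  have h := hc.2 (mem_univ (x : ℝ≥0∞)) (mem_univ (z : ℝ≥0∞)) (zero_le (a := (z - y) / (z - x)))
    (zero_le (a := (y - x) / (z - x))) (by rw [← add_div, hsum, div_self hpos.ne'])
  have hy : ((z - y) / (z - x)) • (x : ℝ≥0∞) + ((y - x) / (z - x)) • (z : ℝ≥0∞) = y := by
    rw [ENNReal.smul_def, ENNReal.smul_def, smul_eq_mul, smul_eq_mul]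
    norm_cast
    rw [div_mul_eq_mul_div, div_mul_eq_mul_div, ← add_div, div_eq_iff hpos.ne']
    apply NNReal.eq
    push_cast [NNReal.coe_sub hxz.le, NNReal.coe_sub hyz.le, NNReal.coe_sub hxy.le]
    ring
  rw [hy] at h
  calc ((z - x : ℝ≥0) : ℝ≥0∞) * φ y
      ≤ ((z - x : ℝ≥0) : ℝ≥0∞) * (((z - y) / (z - x)) • φ x + ((y - x) / (z - x)) • φ z) := by
        gcongr
    _ = _ := by
      rw [mul_add, ENNReal.smul_def, ENNReal.smul_def, smul_eq_mul, smul_eq_mul, ← mul_assoc,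
        ← mul_assoc, ← ENNReal.coe_mul, ← ENNReal.coe_mul, mul_div_cancel₀ _ hpos.ne',
        mul_div_cancel₀ _ hpos.ne']

/-- A supporting line strictly below a value of a convex lower semicontinuous function. -/
theorem exists_slope_of_lt {φ : ℝ≥0∞ → ℝ≥0∞} (hc : ConvexOn ℝ≥0 univ φ)
    (hl : LowerSemicontinuous φ) (hm : Monotone φ) {x c : ℝ≥0} (hx : 0 < x) (hcx : (c : ℝ≥0∞) < φ x) :
    ∃ q : ℝ≥0, ∀ z : ℝ≥0, (z : ℝ≥0∞) * q + c ≤ x * q + φ z := by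
  have hcont := (hl.comp ENNReal.continuous_coe) x c hcx
  obtain ⟨l, hlx, hlc⟩ := exists_Ioc_subset_of_mem_nhds hcont ⟨0, hx⟩
  have hlc' : ∀ z, l < z → (c : ℝ≥0∞) < φ z := by
    intro z hz
    rcases le_total z x with h | h
    · exact hlc ⟨hz, h⟩
    · exact hcx.trans_le (hm (by exact_mod_cast h))
  -- Slopes of the chords joining `(x, c)` to points of the graph on its left; the supremum will be
  -- the slope `q`. The inserted `0` makes `q` nonnegative and `S` nonempty. Starting from the
  -- height `c` rather than `φ x` also covers `φ x = ∞`.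
  set S : Set ℝ := insert 0 {r | ∃ z : ℝ≥0, z < x ∧ φ z ≠ ∞ ∧ r = (c - (φ z).toReal) / (x - z)}
  -- Lower semicontinuity keeps `φ` above `c` on `(l, x]`, so chords from there have negative slope,
  -- while the remaining ones have run at least `x - l`.
  have hub : ∀ r ∈ S, r ≤ c / (x - l) := by
    have hxl : (0 : ℝ) < x - l := sub_pos.2 hlx
    rintro r (rfl | ⟨z, hz, hzt, rfl⟩)
    · positivity
    · have hxz : (0 : ℝ) < x - z := sub_pos.2 hz
      rcases le_or_gt z l with h | h
      · have hzl : (z : ℝ) ≤ l := h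
        gcongr
        linarith [ENNReal.toReal_nonneg (a := φ z)]
      · have h1 : (c : ℝ) < (φ z).toReal :=
          ENNReal.toReal_strict_mono hzt (hlc' z h)
        exact (div_nonpos_of_nonpos_of_nonneg (by linarith) hxz.le).trans (by positivity)
  have hbdd : BddAbove S := ⟨_, hub⟩
  have hq0 : 0 ≤ sSup S := le_csSup hbdd (mem_insert _ _)
  obtain ⟨q, hq⟩ : ∃ q : ℝ≥0, (q : ℝ) = sSup S := ⟨⟨_, hq0⟩, rfl⟩
  refine ⟨q, fun z => ?_⟩
  by_cases hzt : φ z = ∞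
  · simp [hzt]
  have key : (z : ℝ) * sSup S + c ≤ x * sSup S + (φ z).toReal := by
    rcases lt_trichotomy z x with h | rfl | h
    · have h1 : (c - (φ z).toReal) / (x - z) ≤ sSup S :=
        le_csSup hbdd (mem_insert_of_mem _ ⟨z, h, hzt, rfl⟩)
      rw [div_le_iff₀ (sub_pos.2 (by exact_mod_cast h))] at h1
      linarith
    · have h1 : (c : ℝ) < (φ z).toReal := by
        exact ENNReal.toReal_strict_mono hzt hcx
      linarith
    · have hzx : (0 : ℝ) < z - x := sub_pos.2 (by exact_mod_cast h)
      have hxt : φ x ≠ ∞ := ne_top_of_le_ne_top hzt (hm (by exact_mod_cast h.le))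
      have hcx' : (c : ℝ) < (φ x).toReal := by
        exact ENNReal.toReal_strict_mono hxt hcx
      have hcz : (φ x).toReal ≤ (φ z).toReal :=
        ENNReal.toReal_mono hzt (hm (by exact_mod_cast h.le))
      -- Convexity at `p < x < z`, with `c < φ x`, puts every left slope below the slope to the
      -- right.
      have : sSup S ≤ ((φ z).toReal - c) / (z - x) := by
        refine csSup_le ⟨0, mem_insert _ _⟩ ?_
        rintro r (rfl | ⟨p, hp, hpt, rfl⟩)
        · exact div_nonneg (by linarith) hzx.le
        · have hxp : (0 : ℝ) < x - p := sub_pos.2 (by exact_mod_cast hp)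
          rw [div_le_div_iff₀ hxp hzx]
          have h3 := ENNReal.toReal_mono (by finiteness) (convex_three_points hc hp h)
          rw [ENNReal.toReal_add (by finiteness) (by finiteness), ENNReal.toReal_mul,
            ENNReal.toReal_mul, ENNReal.toReal_mul, ENNReal.coe_toReal, ENNReal.coe_toReal,
            ENNReal.coe_toReal, NNReal.coe_sub (hp.trans h).le, NNReal.coe_sub h.le,
            NNReal.coe_sub hp.le] at h3
          nlinarith
      rw [le_div_iff₀ hzx] at this
      linarith
  rw [← hq] at key
  lift φ z to ℝ≥0 using hzt with p
  exact_mod_cast key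

/-- The biconjugate of `Φ` is `Φ`. -/
theorem eq_iSup_sub_complementary (hc : ConvexOn ℝ≥0 univ (Φ t)) (hl : LowerSemicontinuous (Φ t))
    (h0 : Φ t 0 = 0) (hm : Monotone (Φ t)) (ht : Φ t ∞ = ∞)
    (x : ℝ≥0) :
    Φ t x = ⨆ n, ((x : ℝ≥0∞) * nnrealSeq n - complementary Φ t (nnrealSeq n)) := by
  apply le_antisymm
  · rcases eq_or_ne x 0 with rfl | hx
    · simp [h0]
    refine le_of_forall_lt fun c hc' => ?_
    obtain ⟨c', hcc', hc'x⟩ := ENNReal.lt_iff_exists_nnreal_btwn.1 hc'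
    obtain ⟨q, hq⟩ := exists_slope_of_lt hc hl hm (pos_iff_ne_zero.2 hx) hc'x
    have h1 : c < (x : ℝ≥0∞) * q - complementary Φ t q := by
      refine hcc'.trans_le ?_
      -- The line of slope `q` through `(x, c')` lies below `Φ t`, which bounds the conjugate at
      -- `q`. Where the truncated difference is `0`, the line at `z = 0` supplies `c' ≤ x * q`.
      have h2 : complementary Φ t q ≤ x * q - c' := by
        refine iSup₂_le fun z _ => ?_
        refine ENNReal.le_sub_of_add_le_right ENNReal.coe_ne_top ?_
        rcases le_total ((z : ℝ≥0∞) * q) (Φ t z) with h | h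
        · rw [tsub_eq_zero_of_le h, zero_add]
          simpa [h0] using hq 0
        · by_cases hzt : Φ t z = ∞
          · simpa [hzt, h0] using hq 0
          have hz : z ≠ ∞ := by rintro rfl; exact hzt ht
          lift z to ℝ≥0 using hz
          rw [ENNReal.sub_add_eq_add_sub h hzt, tsub_le_iff_right]
          exact hq z
      have h3 : (c' : ℝ≥0∞) ≤ x * q := by simpa [h0] using hq 0
      refine ENNReal.le_sub_of_add_le_right ?_ ?_
      · exact ne_top_of_le_ne_top (by finiteness) h2
      · calc (c' : ℝ≥0∞) + complementary Φ t q ≤ c' + (x * q - c') := by gcongr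
          _ = _ := add_tsub_cancel_of_le h3
    rcases eq_or_ne q 0 with rfl | hq0
    · exact absurd h1 (by simp)
    have hcont : Continuous fun z : ℝ≥0 => (x : ℝ≥0∞) * z - complementary Φ t q :=
      (ENNReal.continuous_sub_right _).comp
        ((ENNReal.continuous_const_mul ENNReal.coe_ne_top).comp ENNReal.continuous_coe)
    obtain ⟨n, h4, h5⟩ := exists_nnrealSeq_lt_of_isOpen (isOpen_Ioi.preimage hcont)
      (show q ∈ _ ⁻¹' Ioi c from h1) (pos_iff_ne_zero.2 hq0)
    refine lt_of_lt_of_le (show c < _ from h4) (le_iSup_of_le n ?_)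
    exact tsub_le_tsub_left (complementary_mono (by exact_mod_cast h5.le)) _
  · refine iSup_le fun n => ?_
    rw [tsub_le_iff_right]
    exact young Φ t _ _

/-- Slopes of chords ending at `x` increase as the other end approaches `x`, so each one is
eventually a lower bound, hence below the `limsup`. -/
theorem div_le_leftDeriv {φ : ℝ≥0∞ → ℝ≥0∞} (hc : ConvexOn ℝ≥0 univ φ) (hm : Monotone φ)
    {x z : ℝ≥0} (hx : φ x ≠ ∞) (hz : z < x) : (φ x - φ z) / (x - z) ≤ leftDeriv φ x := by
  rw [leftDeriv, if_neg hx]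
  have : (𝓝[<] (x : ℝ≥0∞)).NeBot :=
    nhdsLT_neBot_of_exists_lt ⟨z, by exact_mod_cast hz⟩
  refine le_limsup_of_frequently_le (Eventually.frequently ?_)
  filter_upwards [Ioo_mem_nhdsLT (show (z : ℝ≥0∞) < x by exact_mod_cast hz)] with y hy
  have hyt : y ≠ ∞ := ne_top_of_lt hy.2
  lift y to ℝ≥0 using hyt
  have hzy : z < y := by exact_mod_cast hy.1
  have hyx : y < x := by exact_mod_cast hy.2
  have h3 := convex_three_points hc hzy hyx
  have hxy' : φ y ≤ φ x := hm hy.2.le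
  have hzy' : φ z ≤ φ y := hm hy.1.le
  have hyt : φ y ≠ ∞ := ne_top_of_le_ne_top hx hxy'
  have hzt : φ z ≠ ∞ := ne_top_of_le_ne_top hyt hzy'
  rw [← ENNReal.coe_sub, ← ENNReal.coe_sub]
  lift φ x to ℝ≥0 using hx with a
  lift φ y to ℝ≥0 using hyt with b
  lift φ z to ℝ≥0 using hzt with c
  norm_cast at *
  rw [← ENNReal.coe_div (tsub_pos_of_lt (hzy.trans hyx)).ne',
    ← ENNReal.coe_div (tsub_pos_of_lt hyx).ne', ENNReal.coe_le_coe,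
    div_le_div_iff₀ (tsub_pos_of_lt (hzy.trans hyx)) (tsub_pos_of_lt hyx), ← NNReal.coe_le_coe]
  rw [← NNReal.coe_le_coe] at h3
  push_cast [NNReal.coe_sub hxy', NNReal.coe_sub (hzy'.trans hxy'), NNReal.coe_sub hyx.le,
    NNReal.coe_sub hzy.le, NNReal.coe_sub (hzy.trans hyx).le] at h3 ⊢
  linarith

theorem rightDeriv_le_div {φ : ℝ≥0∞ → ℝ≥0∞} (hc : ConvexOn ℝ≥0 univ φ) (hm : Monotone φ)
    {x z : ℝ≥0} (hz : φ z ≠ ∞) (hxz : x < z) : rightDeriv φ x ≤ (φ z - φ x) / (z - x) := by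
  have hx : φ x ≠ ∞ := ne_top_of_le_ne_top hz (hm (by exact_mod_cast hxz.le))
  rw [rightDeriv, if_neg hx]
  refine limsup_le_of_le (h := ?_)
  filter_upwards [Ioo_mem_nhdsGT (show (x : ℝ≥0∞) < z by exact_mod_cast hxz)] with y hy
  have hyt : y ≠ ∞ := ne_top_of_lt hy.2
  lift y to ℝ≥0 using hyt
  have hxy : x < y := by exact_mod_cast hy.1
  have hyz : y < z := by exact_mod_cast hy.2
  have h3 := convex_three_points hc hxy hyz
  have hyz' : φ y ≤ φ z := hm hy.2.le
  have hxy' : φ x ≤ φ y := hm hy.1.le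
  have hyt : φ y ≠ ∞ := ne_top_of_le_ne_top hz hyz'
  rw [← ENNReal.coe_sub, ← ENNReal.coe_sub]
  lift φ x to ℝ≥0 using hx with a
  lift φ y to ℝ≥0 using hyt with b
  lift φ z to ℝ≥0 using hz with c
  norm_cast at *
  rw [← ENNReal.coe_div (tsub_pos_of_lt (hxy.trans hyz)).ne',
    ← ENNReal.coe_div (tsub_pos_of_lt hxy).ne', ENNReal.coe_le_coe,
    div_le_div_iff₀ (tsub_pos_of_lt hxy) (tsub_pos_of_lt (hxy.trans hyz)), ← NNReal.coe_le_coe]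
  rw [← NNReal.coe_le_coe] at h3
  push_cast [NNReal.coe_sub hxy', NNReal.coe_sub hyz', NNReal.coe_sub hyz.le,
    NNReal.coe_sub hxy.le, NNReal.coe_sub (hxy'.trans hyz'), NNReal.coe_sub (hxy.trans hyz).le] at h3 ⊢
  linarith

/-- Equality in Young's inequality characterises the subdifferential. -/
theorem mem_subdiff_iff (hc : ConvexOn ℝ≥0 univ (Φ t)) (h0 : Φ t 0 = 0) (ht : Φ t ∞ = ∞)
    {x y : ℝ≥0} (hx : Φ t x ≠ ∞) :
    (y : ℝ≥0∞) ∈ subdiff (Φ t) x ↔ Φ t x + complementary Φ t y = x * y := by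
  have hm := monotone_of_convex hc h0 ht
  constructor
  · rintro ⟨hl, hr⟩
    refine le_antisymm ?_ (young Φ t x y)
    -- The subgradient inequality, written without subtraction so that infinite values cause no
    -- trouble. Taking the supremum over `z` turns it into equality in Young's inequality.
    have key : ∀ z : ℝ≥0, (z : ℝ≥0∞) * y + Φ t x ≤ x * y + Φ t z := by
      intro z
      by_cases hz : Φ t z = ∞
      · simp [hz]
      rcases lt_trichotomy z x with h | rfl | h
      · have h1 := (div_le_leftDeriv hc hm hx h).trans hl
        have h2 : Φ t z ≤ Φ t x := hm (by exact_mod_cast h.le)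
        rw [← ENNReal.coe_sub] at h1
        lift Φ t x to ℝ≥0 using hx with a
        lift Φ t z to ℝ≥0 using hz with b
        norm_cast at *
        rw [← ENNReal.coe_div (tsub_pos_of_lt h).ne', ENNReal.coe_le_coe,
          div_le_iff₀ (tsub_pos_of_lt h), ← NNReal.coe_le_coe] at h1
        rw [← NNReal.coe_le_coe]
        push_cast [NNReal.coe_sub h2, NNReal.coe_sub h.le] at h1 ⊢
        linarith
      · exact le_rfl
      · have h1 := hr.trans (rightDeriv_le_div hc hm hz h)
        have h2 : Φ t x ≤ Φ t z := hm (by exact_mod_cast h.le)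
        rw [← ENNReal.coe_sub] at h1
        lift Φ t x to ℝ≥0 using hx with a
        lift Φ t z to ℝ≥0 using hz with b
        norm_cast at *
        rw [← ENNReal.coe_div (tsub_pos_of_lt h).ne', ENNReal.coe_le_coe,
          le_div_iff₀ (tsub_pos_of_lt h), ← NNReal.coe_le_coe] at h1
        rw [← NNReal.coe_le_coe]
        push_cast [NNReal.coe_sub h2, NNReal.coe_sub h.le] at h1 ⊢
        linarith
    have h1 : Φ t x ≤ x * y := by simpa [h0] using key 0
    calc Φ t x + complementary Φ t y ≤ Φ t x + (x * y - Φ t x) := by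
          gcongr
          refine iSup₂_le fun z _ => ?_
          by_cases hz : z = ∞
          · simp [hz, ht]
          lift z to ℝ≥0 using hz
          rw [tsub_le_iff_right, ← ENNReal.sub_add_eq_add_sub h1 hx |>.symm]
          exact ENNReal.le_sub_of_add_le_right hx (key z)
      _ = _ := add_tsub_cancel_of_le h1
  · intro h
    have key : ∀ z : ℝ≥0∞, z * y + Φ t x ≤ x * y + Φ t z := by
      intro z
      rw [← h]
      calc z * y + Φ t x ≤ (Φ t z + complementary Φ t y) + Φ t x := by
            gcongr; exact young Φ t z y
        _ = _ := by ring
    constructor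
    · rw [leftDeriv, if_neg hx]
      refine limsup_le_of_le (h := ?_)
      filter_upwards [self_mem_nhdsWithin] with z hz
      have hz : z < x := hz
      have h1 := key z
      have h2 : Φ t z ≤ Φ t x := hm hz.le
      have hzt : Φ t z ≠ ∞ := ne_top_of_le_ne_top hx h2
      have hzt' : z ≠ ∞ := ne_top_of_lt hz
      lift z to ℝ≥0 using hzt'
      rw [← ENNReal.coe_sub]
      lift Φ t x to ℝ≥0 using hx with a
      lift Φ t z to ℝ≥0 using hzt with b
      norm_cast at *
      rw [← ENNReal.coe_div (tsub_pos_of_lt hz).ne', ENNReal.coe_le_coe,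
        div_le_iff₀ (tsub_pos_of_lt hz), ← NNReal.coe_le_coe]
      rw [← NNReal.coe_le_coe] at h1
      push_cast [NNReal.coe_sub h2, NNReal.coe_sub hz.le] at h1 ⊢
      linarith
    · rw [rightDeriv, if_neg hx]
      refine le_limsup_of_frequently_le (Eventually.frequently ?_)
      filter_upwards [Ioo_mem_nhdsGT (ENNReal.coe_lt_top (r := x))] with z hz
      have hzx : x < z := hz.1
      have h1 := key z
      have h2 : Φ t x ≤ Φ t z := hm hzx.le
      have hzt' : z ≠ ∞ := hz.2.ne
      lift z to ℝ≥0 using hzt'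
      rw [← ENNReal.coe_sub]
      by_cases hzt : Φ t z = ∞
      · simp [hzt, hx, ENNReal.top_div]
      lift Φ t x to ℝ≥0 using hx with a
      lift Φ t z to ℝ≥0 using hzt with b
      norm_cast at *
      rw [← ENNReal.coe_div (tsub_pos_of_lt hzx).ne', ENNReal.coe_le_coe,
        le_div_iff₀ (tsub_pos_of_lt hzx), ← NNReal.coe_le_coe]
      rw [← NNReal.coe_le_coe] at h1
      push_cast [NNReal.coe_sub h2, NNReal.coe_sub hzx.le] at h1 ⊢
      linarith

end Pointwise

end MusielakOrlicz

/-! ### Measurable selection for integrals of suprema. -/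

namespace MusielakOrlicz

theorem measurable_realSign : Measurable Real.sign := by
  unfold Real.sign
  exact Measurable.ite measurableSet_Iio measurable_const
    (Measurable.ite measurableSet_Ioi measurable_const measurable_const)

theorem abs_realSign_le_one (x : ℝ) : |Real.sign x| ≤ 1 := by
  rcases Real.sign_apply_eq x with h | h | h <;> simp [h]

theorem mul_realSign_self (x : ℝ) : x * Real.sign x = |x| := by
  rcases lt_trichotomy x 0 with h | h | h
  · rw [Real.sign_of_neg h, abs_of_neg h]; ring
  · simp [h]
  · rw [Real.sign_of_pos h, abs_of_pos h]; ring

theorem realSign_mul_abs (x : ℝ) : Real.sign x * |x| = x := by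
  rcases lt_trichotomy x 0 with h | h | h
  · rw [Real.sign_of_neg h, abs_of_neg h]; ring
  · simp [h]
  · rw [Real.sign_of_pos h, abs_of_pos h]; ring

section Selection

variable {T : Type*} [MeasurableSpace T] {μ : Measure T}

/-- A measurable choice of an index at which a finite maximum is attained. -/
theorem exists_measurable_argmax {g : ℕ → T → ℝ≥0∞} (hg : ∀ n, Measurable (g n)) (N : ℕ) :
    ∃ i : T → ℕ, Measurable i ∧ (Measurable fun t => g (i t) t) ∧
      ∀ t, ∀ n ≤ N, g n t ≤ g (i t) t := by
  induction N with
  | zero =>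
    refine ⟨fun _ => 0, measurable_const, hg 0, fun t n hn => ?_⟩
    rw [Nat.le_zero.1 hn]
  | succ N ih =>
    obtain ⟨i, hi, him, hmax⟩ := ih
    have hA : MeasurableSet {t | g (i t) t < g (N + 1) t} := measurableSet_lt him (hg _)
    classical
    refine ⟨fun t => if t ∈ {t | g (i t) t < g (N + 1) t} then N + 1 else i t,
      Measurable.ite hA measurable_const hi, ?_, fun t n hn => ?_⟩
    · have : (fun t => g (if t ∈ {t | g (i t) t < g (N + 1) t} then N + 1 else i t) t) =
          fun t => if t ∈ {t | g (i t) t < g (N + 1) t} then g (N + 1) t else g (i t) t := by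
        funext t; split_ifs <;> rfl
      rw [this]
      exact Measurable.ite hA (hg _) him
    · by_cases h : t ∈ {t | g (i t) t < g (N + 1) t}
      · simp only [h, if_true]
        rcases Nat.le_succ_iff.1 hn with h' | h'
        · exact (hmax t n h').trans (le_of_lt h)
        · rw [h']
      · simp only [h, if_false]
        rcases Nat.le_succ_iff.1 hn with h' | h'
        · exact hmax t n h'
        · rw [h']; exact not_lt.1 h

/-- Interchange of supremum and integral: the integral of the pointwise supremum of
`w y - Ψ(y)` is approximated by measurable selections with finite modular. -/
theorem exists_selection_of_lt_lintegral [SigmaFinite μ] {Ψ : T → ℝ≥0∞ → ℝ≥0∞}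
    (hΨ : ∀ n, AEMeasurable (fun t => Ψ t (nnrealSeq n)) μ) (h0 : ∀ᵐ t ∂μ, Ψ t 0 = 0)
    {w : T → ℝ≥0∞} (hw : Measurable w) {c : ℝ≥0∞}
    (hc : c < ∫⁻ t, ⨆ n, (w t * nnrealSeq n - Ψ t (nnrealSeq n)) ∂μ) :
    ∃ y : T → ℝ≥0, Measurable y ∧ ∫⁻ t, Ψ t (y t) ∂μ ≠ ∞ ∧
      c + ∫⁻ t, Ψ t (y t) ∂μ ≤ ∫⁻ t, w t * y t ∂μ := by
  set g : ℕ → T → ℝ≥0∞ := fun n => (hΨ n).mk _ with hgdef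
  have hg : ∀ n, Measurable (g n) := fun n => (hΨ n).measurable_mk
  have hge : ∀ᵐ t ∂μ, ∀ n, Ψ t (nnrealSeq n) = g n t := ae_all_iff.2 fun n => (hΨ n).ae_eq_mk
  -- Truncation to finite measure and bounded `Ψ`: any selection made inside these sets has finite
  -- modular.
  set A : ℕ → ℕ → Set T := fun N n => spanningSets μ N ∩ {t | g n t ≤ N} with hA
  have hAm : ∀ N n, MeasurableSet (A N n) := fun N n =>
    (measurableSet_spanningSets μ N).inter (measurableSet_le (hg n) measurable_const)
  have hAmono : ∀ n, Monotone fun N => A N n := fun n N M hNM =>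
    inter_subset_inter (monotone_spanningSets μ hNM) fun t (ht : g n t ≤ N) =>
      ht.trans (by exact_mod_cast hNM)
  -- The truncated gains. Their finite maxima `F N` increase to the full supremum, so monotone
  -- convergence yields one `N` that already beats `c`.
  set H : ℕ → ℕ → T → ℝ≥0∞ := fun N n => (A N n).indicator fun t => w t * nnrealSeq n - g n t with hH
  have hHm : ∀ N n, Measurable (H N n) := fun N n =>
    ((hw.mul_const _).sub (hg n)).indicator (hAm N n)
  set F : ℕ → T → ℝ≥0∞ := fun N t => ⨆ n ∈ Finset.range (N + 1), H N n t with hF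
  have hFm : ∀ N, Measurable (F N) := fun N =>
    Measurable.iSup fun n => Measurable.iSup fun _ => hHm N n
  have hFmono : Monotone F := by
    intro N M hNM t
    refine iSup₂_le fun n hn => ?_
    refine le_iSup₂_of_le (f := fun n _ => H M n t) n
      (Finset.mem_range.2 ((Finset.mem_range.1 hn).trans_le (by omega))) ?_
    exact indicator_le_indicator_of_subset (hAmono n hNM) (fun _ => zero_le) t
  have hsup : (fun t => ⨆ n, (w t * nnrealSeq n - Ψ t (nnrealSeq n))) =ᵐ[μ] fun t => ⨆ N, F N t := by
    filter_upwards [hge] with t ht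
    apply le_antisymm
    · refine iSup_le fun n => ?_
      rw [ht n]
      by_cases hgt : g n t = ∞
      · simp [hgt]
      obtain ⟨m, hm⟩ := ENNReal.exists_nat_gt hgt
      set N := max (max n m) (spanningSetsIndex μ t)
      have htA : t ∈ A N n :=
        ⟨monotone_spanningSets μ (le_max_right _ _) (mem_spanningSetsIndex μ t),
          hm.le.trans (by exact_mod_cast (le_max_right n m).trans (le_max_left _ _))⟩
      refine le_iSup_of_le N (le_iSup₂_of_le (f := fun n _ => H N n t) n
        (Finset.mem_range.2 (Nat.lt_succ_of_le ((le_max_left n m).trans (le_max_left _ _)))) ?_)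
      rw [hH]; simp only [indicator_of_mem htA]; exact le_rfl
    · refine iSup_le fun N => iSup₂_le fun n _ => le_iSup_of_le n ?_
      rw [ht n]
      exact indicator_le_self' (fun _ _ => zero_le) t
  rw [lintegral_congr_ae hsup, lintegral_iSup hFm hFmono, lt_iSup_iff] at hc
  obtain ⟨N, hN⟩ := hc
  obtain ⟨i, hi, him, hmax⟩ := exists_measurable_argmax (hHm N) N
  have hpos : MeasurableSet {t | 0 < H N (i t) t} := measurableSet_lt measurable_const him
  have hd : Measurable fun t => nnrealSeq (i t) := (measurable_from_nat (f := nnrealSeq)).comp hi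
  -- Taking `y = 0` where the gain vanishes avoids points outside `A` and points where the
  -- subtraction truncates; elsewhere `H + Ψ(y) = w y` holds exactly.
  set y : T → ℝ≥0 := {t | 0 < H N (i t) t}.indicator fun t => nnrealSeq (i t) with hy
  have hym : Measurable y := hd.indicator hpos
  have hbound : ∀ᵐ t ∂μ, Ψ t (y t) ≤ (spanningSets μ N).indicator (fun _ => (N : ℝ≥0∞)) t ∧
      H N (i t) t + Ψ t (y t) = w t * y t := by
    filter_upwards [hge, h0] with t h1 h2
    by_cases ht : 0 < H N (i t) t
    · have hyt : y t = nnrealSeq (i t) := indicator_of_mem (s := {t | 0 < H N (i t) t}) ht _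
      have htA : t ∈ A N (i t) := by
        by_contra hn
        rw [hH] at ht; simp only [indicator_of_notMem hn] at ht; exact lt_irrefl _ ht
      have hHt : H N (i t) t = w t * nnrealSeq (i t) - g (i t) t := by
        rw [hH]; simp only [indicator_of_mem htA]
      rw [hyt, h1, indicator_of_mem htA.1]
      refine ⟨htA.2, ?_⟩
      rw [hHt] at ht ⊢
      exact tsub_add_cancel_of_le (tsub_pos_iff_lt.1 ht).le
    · have hyt : y t = 0 := indicator_of_notMem (s := {t | 0 < H N (i t) t}) ht _
      rw [hyt, ENNReal.coe_zero, h2]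
      exact ⟨zero_le, by simpa using ht⟩
  have hfin : ∫⁻ t, Ψ t (y t) ∂μ ≠ ∞ := by
    refine ne_top_of_le_ne_top ?_ (lintegral_mono_ae (hbound.mono fun t ht => ht.1))
    rw [lintegral_indicator_const (measurableSet_spanningSets μ N)]
    exact ENNReal.mul_ne_top (ENNReal.natCast_ne_top N) (measure_spanningSets_lt_top μ N).ne
  refine ⟨y, hym, hfin, ?_⟩
  rw [← lintegral_congr_ae (hbound.mono fun t ht => ht.2), lintegral_add_left him]
  gcongr
  refine hN.le.trans (lintegral_mono fun t => ?_)
  exact iSup₂_le fun n hn => hmax t n (Nat.lt_succ_iff.1 (Finset.mem_range.1 hn))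

end Selection

/-! ### Amemiya's formula for the Orlicz norm. -/

section Amemiya

variable {T : Type*} [MeasurableSpace T] {Φ : T → ℝ≥0∞ → ℝ≥0∞} {μ : Measure T}

theorem IsMusielakOrlicz.aemeasurable_complementary (h : IsMusielakOrlicz Φ μ) {y : T → ℝ≥0∞}
    (hy : AEMeasurable y μ) (hyt : ∀ t, y t ≠ ∞) :
    AEMeasurable (fun t => complementary Φ t (y t)) μ := by
  have : (fun t => complementary Φ t (y t)) =ᵐ[μ]
      fun t => ⨆ n, (nnrealSeq n * y t - Φ t (nnrealSeq n)) := by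
    filter_upwards [h.monotone, h.top] with t h1 h2
    exact complementary_eq_iSup_nnrealSeq h1 h2 (hyt t)
  exact (AEMeasurable.iSup fun n => (hy.const_mul _).sub (h.measurable _)).congr this.symm

theorem lintegral_mul_ne_top (h : IsMusielakOrlicz Φ μ) {w : T →ₘ[μ] ℝ}
    (hw : w ∈ orliczSet Φ μ) {y : T → ℝ≥0∞} (hy : ∫⁻ t, complementary Φ t (y t) ∂μ ≠ ∞) :
    ∫⁻ t, ‖w t‖ₑ * y t ∂μ ≠ ∞ := by
  obtain ⟨a, ha, haw⟩ := hw
  have h1 : ‖a‖ₑ * ∫⁻ t, ‖w t‖ₑ * y t ∂μ ≤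
      modular Φ μ (a • w) + ∫⁻ t, complementary Φ t (y t) ∂μ := by
    rw [modular_smul, ← lintegral_add_left' (h.aemeasurable_modular _ _),
      ← lintegral_const_mul' _ _ enorm_ne_top]
    refine lintegral_mono fun t => ?_
    rw [← mul_assoc]
    exact young Φ t _ _
  have h2 := ne_top_of_le_ne_top (by finiteness) h1
  exact (ENNReal.lt_top_of_mul_ne_top_right h2 (by simpa using ha.ne')).ne

/-- Testing the norm with `sign(w) · y` turns the signed supremum into a problem over nonnegative
`y`. -/
theorem lintegral_mul_le_orliczNorm (h : IsMusielakOrlicz Φ μ) {w : T →ₘ[μ] ℝ}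
    (hw : w ∈ orliczSet Φ μ) {y : T → ℝ≥0} (hym : Measurable y)
    (hy : ∫⁻ t, complementary Φ t (y t) ∂μ ≤ 1) :
    ∫⁻ t, ‖w t‖ₑ * y t ∂μ ≤ ENNReal.ofReal (orliczNorm Φ μ w) := by
  have hvm : AEStronglyMeasurable (fun t => Real.sign (w t) * (y t : ℝ)) μ :=
    ((measurable_realSign.comp w.measurable).mul hym.coe_nnreal_real).aestronglyMeasurable
  have hv : modular (complementary Φ) μ (AEEqFun.mk _ hvm) ≤ 1 := by
    refine le_trans (lintegral_mono_ae ?_) hy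
    filter_upwards [AEEqFun.coeFn_mk _ hvm] with t ht
    rw [ht, enorm_mul]
    apply complementary_mono
    have h1 : ‖Real.sign (w t)‖ₑ ≤ 1 := by
      rw [← ofReal_norm, ← ENNReal.ofReal_one]
      exact ENNReal.ofReal_le_ofReal (abs_realSign_le_one _)
    have h2 : ‖(y t : ℝ)‖ₑ = y t := by
      rw [← ofReal_norm, Real.norm_of_nonneg (NNReal.coe_nonneg _)]; simp
    rw [h2]
    exact mul_le_of_le_one_left zero_le h1
  have h1 := abs_integral_le_orliczNorm h hw hv
  have h2 : ∀ᵐ t ∂μ, w t * (AEEqFun.mk _ hvm : T →ₘ[μ] ℝ) t = |w t| * y t := by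
    filter_upwards [AEEqFun.coeFn_mk _ hvm] with t ht
    rw [ht, ← mul_assoc, mul_realSign_self]
  have hint := (integrable_mul_of_modular h hw hv).congr h2
  rw [integral_congr_ae h2] at h1
  calc ∫⁻ t, ‖w t‖ₑ * y t ∂μ = ∫⁻ t, ENNReal.ofReal (|w t| * y t) ∂μ := by
        refine lintegral_congr fun t => ?_
        rw [ENNReal.ofReal_mul (abs_nonneg _), ← Real.norm_eq_abs, ofReal_norm]; simp
    _ = ENNReal.ofReal (∫ t, |w t| * y t ∂μ) :=
        (ofReal_integral_eq_lintegral_ofReal hint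
          (Eventually.of_forall fun t => by positivity)).symm
    _ ≤ _ := ENNReal.ofReal_le_ofReal ((le_abs_self _).trans h1)

/-- A Lagrange multiplier for the maximisation of `∫ |w| y` under `I_{Φ*}(y) ≤ 1`. -/
theorem exists_multiplier (h : IsMusielakOrlicz Φ μ) {w : T →ₘ[μ] ℝ} (hw : w ∈ orliczSet Φ μ) :
    ∃ l : ℝ, 0 ≤ l ∧ ∀ y : T → ℝ≥0, Measurable y → ∫⁻ t, complementary Φ t (y t) ∂μ ≠ ∞ →
      (∫⁻ t, ‖w t‖ₑ * y t ∂μ).toReal + l ≤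
        orliczNorm Φ μ w + l * (∫⁻ t, complementary Φ t (y t) ∂μ).toReal := by
  set N := orliczNorm Φ μ w
  have hN : 0 ≤ N := orliczNorm_nonneg w
  set A : (T → ℝ≥0) → ℝ := fun y => (∫⁻ t, ‖w t‖ₑ * y t ∂μ).toReal with hA
  set B : (T → ℝ≥0) → ℝ := fun y => (∫⁻ t, complementary Φ t (y t) ∂μ).toReal with hB
  have hAN : ∀ y : T → ℝ≥0, Measurable y → ∫⁻ t, complementary Φ t (y t) ∂μ ≠ ∞ → B y ≤ 1 → A y ≤ N := by
    intro y hy hyt hy1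
    refine ENNReal.toReal_le_of_le_ofReal hN (lintegral_mul_le_orliczNorm h hw hy ?_)
    rw [← ENNReal.toReal_le_toReal hyt ENNReal.one_ne_top]; simpa using hy1
  -- The combination of `y` and `z` with weights chosen so that `a * B y + b * B z = 1` is feasible
  -- by convexity, and `A` is linear. Its bound by `N` compares the slope beyond the constraint
  -- level with the slope before it.
  have hcomb : ∀ y z : T → ℝ≥0, Measurable y → Measurable z →
      ∫⁻ t, complementary Φ t (y t) ∂μ ≠ ∞ → ∫⁻ t, complementary Φ t (z t) ∂μ ≠ ∞ →
      1 < B y → B z < 1 → (A y - N) / (B y - 1) ≤ (N - A z) / (1 - B z) := by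
    intro y z hy hz hyt hzt hBy hBz
    have hd : 0 < B y - B z := by linarith
    set a : ℝ≥0 := ⟨(1 - B z) / (B y - B z), div_nonneg (by linarith) hd.le⟩ with ha
    set b : ℝ≥0 := ⟨(B y - 1) / (B y - B z), div_nonneg (by linarith) hd.le⟩ with hb
    have ha' : (a : ℝ) = (1 - B z) / (B y - B z) := rfl
    have hb' : (b : ℝ) = (B y - 1) / (B y - B z) := rfl
    have hab : a + b = 1 := by
      apply NNReal.eq; push_cast; rw [ha', hb', ← add_div, div_eq_one_iff_eq hd.ne']; ring
    have hxm : Measurable fun t => a * y t + b * z t := (hy.const_mul a).add (hz.const_mul b)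
    have hle : ∫⁻ t, complementary Φ t ((a * y t + b * z t : ℝ≥0) : ℝ≥0∞) ∂μ ≤
        a * ∫⁻ t, complementary Φ t (y t) ∂μ + b * ∫⁻ t, complementary Φ t (z t) ∂μ := by
      rw [← lintegral_const_mul' _ _ ENNReal.coe_ne_top,
        ← lintegral_const_mul' _ _ ENNReal.coe_ne_top, ← lintegral_add_left'
          ((h.aemeasurable_complementary hy.coe_nnreal_ennreal.aemeasurable
            fun t => ENNReal.coe_ne_top).const_mul _)]
      refine lintegral_mono fun t => ?_
      push_cast
      exact complementary_convex_comb (by exact_mod_cast hab) _ _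
    have hne : a * ∫⁻ t, complementary Φ t (y t) ∂μ + b * ∫⁻ t, complementary Φ t (z t) ∂μ ≠ ∞ := by
      finiteness
    have h1 : B (fun t => a * y t + b * z t) ≤ 1 := by
      refine (ENNReal.toReal_mono hne hle).trans ?_
      rw [ENNReal.toReal_add (by finiteness) (by finiteness), ENNReal.toReal_mul,
        ENNReal.toReal_mul, ENNReal.coe_toReal, ENNReal.coe_toReal, ha', hb']
      change (1 - B z) / (B y - B z) * B y + (B y - 1) / (B y - B z) * B z ≤ 1
      rw [div_mul_eq_mul_div, div_mul_eq_mul_div, ← add_div, div_le_one hd]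
      linarith
    have h2 := hAN _ hxm (ne_top_of_le_ne_top hne hle) h1
    have h3 : A (fun t => a * y t + b * z t) = a * A y + b * A z := by
      have hyA := lintegral_mul_ne_top h hw hyt
      have hzA := lintegral_mul_ne_top h hw hzt
      have hwy : AEMeasurable (fun t => ‖w t‖ₑ * y t) μ :=
        w.aestronglyMeasurable.enorm.mul hy.coe_nnreal_ennreal.aemeasurable
      have : ∫⁻ t, ‖w t‖ₑ * ((a * y t + b * z t : ℝ≥0) : ℝ≥0∞) ∂μ =
          a * ∫⁻ t, ‖w t‖ₑ * y t ∂μ + b * ∫⁻ t, ‖w t‖ₑ * z t ∂μ := by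
        rw [← lintegral_const_mul' _ _ ENNReal.coe_ne_top,
          ← lintegral_const_mul' _ _ ENNReal.coe_ne_top, ← lintegral_add_left'
            (hwy.const_mul _)]
        refine lintegral_congr fun t => ?_
        push_cast; ring
      simp only [hA]
      rw [this, ENNReal.toReal_add (by finiteness) (by finiteness), ENNReal.toReal_mul,
        ENNReal.toReal_mul, ENNReal.coe_toReal, ENNReal.coe_toReal]
    rw [h3, ha', hb', div_mul_eq_mul_div, div_mul_eq_mul_div, ← add_div, div_le_iff₀ hd] at h2
    rw [div_le_div_iff₀ (by linarith) (by linarith)]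
    linarith
  -- Any number between the two families of slopes is a multiplier. The extra `0` forces `l ≥ 0`,
  -- and `y = 0` shows that the upper family is nonempty.
  obtain ⟨l, hl1, hl2⟩ := exists_between_of_forall_le
    (s := insert 0 {r | ∃ y : T → ℝ≥0, Measurable y ∧ ∫⁻ t, complementary Φ t (y t) ∂μ ≠ ∞ ∧
      1 < B y ∧ r = (A y - N) / (B y - 1)})
    (t := {r | ∃ y : T → ℝ≥0, Measurable y ∧ ∫⁻ t, complementary Φ t (y t) ∂μ ≠ ∞ ∧
      B y < 1 ∧ r = (N - A y) / (1 - B y)}) ⟨0, mem_insert _ _⟩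
    ⟨_, fun _ => 0, measurable_const, by simp [complementary_zero],
      by simp [hB, complementary_zero], rfl⟩ (by
        rintro r (rfl | ⟨y, hy, hyt, hy1, rfl⟩) s ⟨z, hz, hzt, hz1, rfl⟩
        · exact div_nonneg (by linarith [hAN z hz hzt hz1.le]) (by linarith)
        · exact hcomb y z hy hz hyt hzt hy1 hz1)
  refine ⟨l, hl1 (mem_insert _ _), fun y hy hyt => ?_⟩
  change A y + l ≤ N + l * B y
  rcases lt_trichotomy (B y) 1 with hy1 | hy1 | hy1
  · have := hl2 ⟨y, hy, hyt, hy1, rfl⟩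
    rw [le_div_iff₀ (by linarith)] at this
    linarith
  · have := hAN y hy hyt hy1.le
    rw [hy1]; linarith
  · have := hl1 (mem_insert_of_mem _ ⟨y, hy, hyt, hy1, rfl⟩)
    rw [div_le_iff₀ (by linarith)] at this
    linarith

/-- The nontrivial half of Amemiya's formula for the Orlicz norm. -/
theorem exists_one_add_modular_le [SigmaFinite μ] (h : IsMusielakOrlicz Φ μ) {w : T →ₘ[μ] ℝ}
    (hw : w ∈ orliczSet Φ μ) {e : ℝ} (he : 0 < e) :
    ∃ k : ℝ, 0 < k ∧ 1 + modular Φ μ (k • w) ≤ ENNReal.ofReal (k * (orliczNorm Φ μ w + e)) := by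
  obtain ⟨l, hl0, hl⟩ := exists_multiplier h hw
  set N := orliczNorm Φ μ w
  have hle : 0 < l + e := by linarith
  -- The minimizer should be the reciprocal of the multiplier; adding `e` covers `l = 0` and leaves
  -- `k * l ≤ 1`.
  set k := (l + e)⁻¹ with hk
  have hk0 : 0 < k := inv_pos.2 hle
  have hkl : k * l + k * e = 1 := by rw [← mul_add]; exact inv_mul_cancel₀ hle.ne'
  refine ⟨k, hk0, ?_⟩
  -- Testing the multiplier with `y = 0` gives `l ≤ N`, hence `1 = k * (l + e) ≤ k * (N + e)`.
  have hN := hl (fun _ => 0) measurable_const (by simp [complementary_zero])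
  simp only [ENNReal.coe_zero, mul_zero, lintegral_zero, ENNReal.toReal_zero, zero_add,
    complementary_zero, add_zero] at hN
  have h1 : 1 ≤ k * (N + e) := by nlinarith
  have key : modular Φ μ (k • w) ≤ ENNReal.ofReal (k * (N + e) - 1) := by
    refine ENNReal.le_of_forall_nnreal_lt fun c hc => ?_
    have hsup : modular Φ μ (k • w) = ∫⁻ t, ⨆ n, (‖k‖ₑ * ‖w t‖ₑ * nnrealSeq n -
        complementary Φ t (nnrealSeq n)) ∂μ := by
      rw [modular_smul]
      refine lintegral_congr_ae ?_
      filter_upwards [h.convex, h.lsc, h.zero, h.monotone, h.top] with t h1 h2 h3 h4 h5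
      have := eq_iSup_sub_complementary h1 h2 h3 h4 h5 (‖k‖₊ * ‖w t‖₊)
      rw [ENNReal.coe_mul] at this
      exact this
    rw [hsup] at hc
    obtain ⟨y, hy, hyt, hyc⟩ := exists_selection_of_lt_lintegral (Ψ := complementary Φ)
      (fun n => h.aemeasurable_complementary aemeasurable_const fun t => ENNReal.coe_ne_top)
      (Eventually.of_forall fun t => complementary_zero) (w.measurable.enorm.const_mul _) hc
    have hA := lintegral_mul_ne_top h hw hyt
    have h2 := hl y hy hyt
    simp only [mul_assoc] at hyc
    rw [lintegral_const_mul' _ _ enorm_ne_top] at hyc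
    have h3 := ENNReal.toReal_mono (by finiteness) hyc
    rw [ENNReal.toReal_add ENNReal.coe_ne_top hyt, ENNReal.toReal_mul, toReal_enorm,
      Real.norm_of_nonneg hk0.le, ENNReal.coe_toReal] at h3
    set A := (∫⁻ t, ‖w t‖ₑ * y t ∂μ).toReal
    set B := (∫⁻ t, complementary Φ t (y t) ∂μ).toReal
    have hB : 0 ≤ B := ENNReal.toReal_nonneg
    -- The multiplier inequality times `k`; as `k * l ≤ 1`, the term `k * l * B` is absorbed by the
    -- `B` gained from the selection.
    have h4 : k * A + k * l ≤ k * N + k * l * B := by nlinarith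
    have h5 : k * l * B ≤ B := mul_le_of_le_one_left hB (by nlinarith)
    rw [← ENNReal.ofReal_coe_nnreal]
    apply ENNReal.ofReal_le_ofReal
    linarith
  calc 1 + modular Φ μ (k • w) ≤ ENNReal.ofReal 1 + ENNReal.ofReal (k * (N + e) - 1) := by
        rw [ENNReal.ofReal_one]; gcongr
    _ = _ := by rw [← ENNReal.ofReal_add zero_le_one (by linarith)]; congr 1; ring

/-- The elementary half of Amemiya's formula for the Orlicz norm. -/
theorem ofReal_mul_orliczNorm_le (h : IsMusielakOrlicz Φ μ) (w : T →ₘ[μ] ℝ) {k : ℝ} (hk : 0 < k) :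
    ENNReal.ofReal (k * orliczNorm Φ μ w) ≤ 1 + modular Φ μ (k • w) := by
  by_cases ht : modular Φ μ (k • w) = ∞
  · simp [ht]
  refine ENNReal.ofReal_le_of_le_toReal ?_
  rw [← le_inv_mul_iff₀ hk]
  refine orliczNorm_le fun v hv => ?_
  rw [le_inv_mul_iff₀ hk]
  have h1 := (lintegral_mul_le h w v k).trans (by gcongr : _ ≤ modular Φ μ (k • w) + 1)
  rw [lintegral_const_mul' _ _ enorm_ne_top] at h1
  have h2 : ‖k‖ₑ * ‖∫ t, w t * v t ∂μ‖ₑ ≤ 1 + modular Φ μ (k • w) := by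
    rw [add_comm]
    exact le_trans (by gcongr; exact enorm_integral_le_lintegral_enorm _) h1
  have h3 := ENNReal.toReal_mono (by finiteness) h2
  rwa [ENNReal.toReal_mul, toReal_enorm, toReal_enorm, Real.norm_of_nonneg hk.le,
    Real.norm_eq_abs] at h3

end Amemiya

end MusielakOrlicz

/-! ### Norm and modular on the Orlicz space. -/

namespace MusielakOrlicz

variable {T : Type*} [MeasurableSpace T] {Φ : T → ℝ≥0∞ → ℝ≥0∞} {μ : Measure T}

theorem IsMusielakOrlicz.tendsto_nhds_zero (h : IsMusielakOrlicz Φ μ) :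
    ∀ᵐ t ∂μ, Tendsto (Φ t) (𝓝 0) (𝓝 0) := by
  filter_upwards [h.zero, h.tendsto_zero] with t h0 h1
  have h2 : ContinuousWithinAt (Φ t) (Ioi 0) 0 := by rw [ContinuousWithinAt, h0]; exact h1
  have h3 := continuousWithinAt_insert_self.2 h2
  have h4 : insert (0 : ℝ≥0∞) (Ioi 0) = univ := by
    ext x; simp
  rw [h4, continuousWithinAt_univ, ContinuousAt, h0] at h3
  exact h3

theorem IsMusielakOrlicz.aemeasurable_enorm (h : IsMusielakOrlicz Φ μ) (u : T →ₘ[μ] ℝ) :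
    AEMeasurable (fun t => Φ t ‖u t‖ₑ) μ :=
  h.aemeasurable_comp u.aestronglyMeasurable.enorm

theorem IsMusielakOrlicz.modular_le_of_abs_le (h : IsMusielakOrlicz Φ μ) {u w : T →ₘ[μ] ℝ}
    (hle : ∀ᵐ t ∂μ, |u t| ≤ |w t|) : modular Φ μ u ≤ modular Φ μ w := by
  refine lintegral_mono_ae ?_
  filter_upwards [h.monotone, hle] with t h1 h2
  apply h1
  rw [← ofReal_norm, ← ofReal_norm]
  exact ENNReal.ofReal_le_ofReal h2

theorem enorm_integral_mul_le (h : IsMusielakOrlicz Φ μ) (u v : T →ₘ[μ] ℝ) :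
    ‖∫ t, u t * v t ∂μ‖ₑ ≤ modular Φ μ u + modular (complementary Φ) μ v := by
  have h1 := lintegral_mul_le h u v 1
  rw [one_smul, enorm_one] at h1
  simp only [one_mul] at h1
  exact (enorm_integral_le_lintegral_enorm _).trans h1

namespace OrliczSpace

variable {h : IsMusielakOrlicz Φ μ}

theorem toL0_sub (u w : OrliczSpace h) : (u - w).toL0 = u.toL0 - w.toL0 := rfl

theorem norm_eq [SigmaFinite μ] (u : OrliczSpace h) : ‖u‖ = orliczNorm Φ μ u.toL0 := rfl

theorem exists_of_abs_le (w : OrliczSpace h) {g : T → ℝ} (hg : AEStronglyMeasurable g μ)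
    (hle : ∀ᵐ t ∂μ, |g t| ≤ |w.toL0 t|) : ∃ x : OrliczSpace h, x.toL0 =ᵐ[μ] g := by
  obtain ⟨l, hl, hlw⟩ := w.toL0_mem
  refine ⟨⟨AEEqFun.mk g hg, l, hl, lt_of_le_of_lt (h.modular_le_of_abs_le ?_) hlw⟩,
    AEEqFun.coeFn_mk g hg⟩
  filter_upwards [hle, AEEqFun.coeFn_mk g hg, AEEqFun.coeFn_smul l (AEEqFun.mk g hg),
    AEEqFun.coeFn_smul l w.toL0] with t h1 h2 h3 h4
  rw [h3, h4, Pi.smul_apply, Pi.smul_apply, h2, smul_eq_mul, smul_eq_mul, abs_mul, abs_mul]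
  gcongr

theorem exists_of_modular {g : T → ℝ} (hg : AEStronglyMeasurable g μ)
    (hm : ∫⁻ t, Φ t ‖g t‖ₑ ∂μ ≠ ∞) : ∃ x : OrliczSpace h, x.toL0 =ᵐ[μ] g := by
  refine ⟨⟨AEEqFun.mk g hg, 1, one_pos, ?_⟩, AEEqFun.coeFn_mk g hg⟩
  rw [one_smul, modular]
  refine lt_of_le_of_lt (le_of_eq (lintegral_congr_ae ?_)) hm.lt_top
  filter_upwards [AEEqFun.coeFn_mk g hg] with t ht
  rw [ht]

theorem norm_le_one_add_modular [SigmaFinite μ] (w : OrliczSpace h)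
    (hw : modular Φ μ w.toL0 ≠ ∞) : ‖w‖ ≤ 1 + (modular Φ μ w.toL0).toReal := by
  have h1 := ofReal_mul_orliczNorm_le h w.toL0 one_pos
  rw [one_smul, one_mul] at h1
  have h2 := (ENNReal.ofReal_le_iff_le_toReal (by finiteness)).1 h1
  rwa [ENNReal.toReal_add ENNReal.one_ne_top hw, ENNReal.toReal_one] at h2

/-- Amemiya's formula with `e = 1 - ‖w‖` gives `1 + I_Φ(kw) ≤ k`, which forces `k ≥ 1` and so
`I_Φ(w) ≤ I_Φ(kw) < ∞`. It places almost norming vectors in the domain of the modular. -/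
theorem modular_ne_top_of_norm_lt_one [SigmaFinite μ] (w : OrliczSpace h) (hw : ‖w‖ < 1) :
    modular Φ μ w.toL0 ≠ ∞ := by
  obtain ⟨k, hk, h1⟩ := exists_one_add_modular_le h w.toL0_mem (sub_pos.2 hw)
  rw [norm_eq, add_sub_cancel, mul_one] at h1
  have hk1 : 1 ≤ k := by
    have := (le_self_add (a := (1 : ℝ≥0∞))).trans h1
    rwa [ENNReal.one_le_ofReal] at this
  have h2 : modular Φ μ (k • w.toL0) ≠ ∞ :=
    ne_top_of_le_ne_top ENNReal.ofReal_ne_top (le_add_self.trans h1)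
  have h3 := h.modular_mono (c := 1) (d := k) (by rwa [abs_one, abs_of_pos hk]) w.toL0
  rw [one_smul] at h3
  exact ne_top_of_le_ne_top h2 h3

end OrliczSpace

/-! ### Purely singular functionals and the dual unit ball. -/

section Dual

variable {h : IsMusielakOrlicz Φ μ} [SigmaFinite μ]

theorem ordContFunctional_apply {v : T →ₘ[μ] ℝ} (hv : v ∈ orliczSet (complementary Φ) μ)
    (w : OrliczSpace h) : ordContFunctional h v hv w = ∫ t, w.toL0 t * v t ∂μ := rfl

/-- Relative to a purely singular functional, every element splits into an almost negligible
part and a part that tends to zero almost everywhere. -/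
theorem IsPurelySingular.exists_decomposition {f : StrongDual ℝ (OrliczSpace h)}
    (hf : IsPurelySingular f) (w : OrliczSpace h) {e : ℝ} (he : 0 < e) :
    ∃ p y : ℕ → OrliczSpace h, (∀ n, w = p n + y n) ∧
      (∀ n, ∀ᵐ t ∂μ, |(p n).toL0 t| ≤ |w.toL0 t|) ∧
      (∀ n, ∀ᵐ t ∂μ, |(y n).toL0 t| ≤ |w.toL0 t|) ∧
      (∀ᵐ t ∂μ, Tendsto (fun n => (p n).toL0 t) atTop (𝓝 (w.toL0 t))) ∧
      (∀ᵐ t ∂μ, Tendsto (fun n => (y n).toL0 t) atTop (𝓝 0)) ∧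
      ∀ n, ∀ z : OrliczSpace h, (∀ᵐ t ∂μ, |z.toL0 t| ≤ |(p n).toL0 t|) → |f z| ≤ e := by
  obtain ⟨a, ha⟩ := OrliczSpace.exists_of_abs_le w (g := fun t => |w.toL0 t|)
    w.toL0.aestronglyMeasurable.norm (by simp)
  have ha0 : 0 ≤ a.toL0 := by
    rw [← AEEqFun.coeFn_le]
    filter_upwards [ha, AEEqFun.coeFn_zero (μ := μ) (β := ℝ)] with t h1 h2
    rw [h1, h2]; exact abs_nonneg _
  -- Pure singularity provides `0 ≤ x n ↑ |w|` with `|f|(x n) < e`; then `p n` is `x n` with the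
  -- sign of `w`, and `y n` is the rest.
  have h1 : absOrdContPart f a < ENNReal.ofReal e := by rw [hf a ha0]; simpa using he
  simp only [absOrdContPart, iInf_lt_iff] at h1
  obtain ⟨x, hx0, hxm, hxt, hxe⟩ := h1
  have hx0' : ∀ᵐ t ∂μ, ∀ n, 0 ≤ (x n).toL0 t := by
    refine ae_all_iff.2 fun n => ?_
    filter_upwards [AEEqFun.coeFn_le.2 (hx0 n), AEEqFun.coeFn_zero (μ := μ) (β := ℝ)] with t h1 h2
    rw [h2] at h1; exact h1
  have hxm' : ∀ᵐ t ∂μ, Monotone fun n => (x n).toL0 t := by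
    have : ∀ᵐ t ∂μ, ∀ n, (x n).toL0 t ≤ (x (n + 1)).toL0 t :=
      ae_all_iff.2 fun n => AEEqFun.coeFn_le.2 (hxm n.le_succ)
    filter_upwards [this] with t ht using monotone_nat_of_le_succ ht
  have hxt' : ∀ᵐ t ∂μ, Tendsto (fun n => (x n).toL0 t) atTop (𝓝 |w.toL0 t|) := by
    filter_upwards [hxt, ha] with t h1 h2
    rwa [h2] at h1
  have hxle : ∀ᵐ t ∂μ, ∀ n, (x n).toL0 t ≤ |w.toL0 t| := by
    filter_upwards [hxm', hxt'] with t h1 h2 n using h1.ge_of_tendsto h2 n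
  have hp : ∀ n, ∃ p : OrliczSpace h, p.toL0 =ᵐ[μ] fun t => Real.sign (w.toL0 t) * (x n).toL0 t := by
    intro n
    refine OrliczSpace.exists_of_abs_le (x n) ((measurable_realSign.comp
      w.toL0.measurable).mul (x n).toL0.measurable).aestronglyMeasurable
      (Eventually.of_forall fun t => ?_)
    rw [abs_mul]
    exact mul_le_of_le_one_left (abs_nonneg _) (abs_realSign_le_one _)
  choose p hp using hp
  have hp' : ∀ᵐ t ∂μ, ∀ n, (p n).toL0 t = Real.sign (w.toL0 t) * (x n).toL0 t := ae_all_iff.2 hp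
  have hple : ∀ᵐ t ∂μ, ∀ n, |(p n).toL0 t| ≤ (x n).toL0 t := by
    filter_upwards [hp', hx0'] with t h1 h2 n
    rw [h1, abs_mul, abs_of_nonneg (h2 n)]
    exact mul_le_of_le_one_left (h2 n) (abs_realSign_le_one _)
  have hy' : ∀ᵐ t ∂μ, ∀ n, (w - p n).toL0 t = w.toL0 t - (p n).toL0 t :=
    ae_all_iff.2 fun n => by
      rw [OrliczSpace.toL0_sub]
      exact AEEqFun.coeFn_sub _ _
  have hpt : ∀ᵐ t ∂μ, Tendsto (fun n => (p n).toL0 t) atTop (𝓝 (w.toL0 t)) := by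
    filter_upwards [hp', hxt'] with t h1 h2
    simp only [h1]
    have := h2.const_mul (Real.sign (w.toL0 t))
    rwa [realSign_mul_abs] at this
  refine ⟨p, fun n => w - p n, fun n => (add_sub_cancel _ _).symm, fun n => ?_, fun n => ?_, hpt,
    ?_, fun n z hz => ?_⟩
  · filter_upwards [hple, hxle] with t h1 h2 using (h1 n).trans (h2 n)
  · filter_upwards [hp', hxle, hx0', hy'] with t h1 h2 h3 h4
    have h5 : w.toL0 t - (p n).toL0 t = Real.sign (w.toL0 t) * (|w.toL0 t| - (x n).toL0 t) := by
      rw [mul_sub, realSign_mul_abs, h1]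
    rw [h4, h5, abs_mul, abs_of_nonneg (sub_nonneg.2 (h2 n))]
    exact (mul_le_of_le_one_left (sub_nonneg.2 (h2 n)) (abs_realSign_le_one _)).trans
      (sub_le_self _ (h3 n))
  · filter_upwards [hpt, hy'] with t h1 h2
    simp only [h2]
    simpa using h1.const_sub (w.toL0 t)
  · have hzx : |z.toL0| ≤ (x n).toL0 := by
      rw [← AEEqFun.coeFn_le]
      filter_upwards [hz, hple, AEEqFun.coeFn_abs z.toL0] with t h1 h2 h3
      rw [h3]; exact h1.trans (h2 n)
    have h2 : ‖f z‖ₑ ≤ ENNReal.ofReal e :=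
      ((le_iSup₂_of_le (f := fun (w : OrliczSpace h) (_ : |w.toL0| ≤ (x n).toL0) => ‖f w‖ₑ)
        z hzx le_rfl).trans (le_iSup (fun n => absFunctional f (x n)) n)).trans hxe.le
    rw [← ofReal_norm, ENNReal.ofReal_le_ofReal_iff he.le] at h2
    exact h2

/-- A purely singular functional is bounded by its norm on the domain of the modular. -/
theorem IsPurelySingular.abs_apply_le_norm {f : StrongDual ℝ (OrliczSpace h)}
    (hf : IsPurelySingular f) (w : OrliczSpace h) (hw : modular Φ μ w.toL0 ≠ ∞) :
    |f w| ≤ ‖f‖ := by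
  refine le_of_forall_pos_le_add fun e he => ?_
  obtain ⟨p, y, hpy, -, hy, -, hyt, hpe⟩ := hf.exists_decomposition w he
  -- Dominated convergence with majorant `Φ(t, |w|)`, integrable precisely because `w` is in the
  -- domain of the modular.
  have hlim : Tendsto (fun n => modular Φ μ (y n).toL0) atTop (𝓝 0) := by
    rw [← lintegral_zero (μ := μ)]
    refine tendsto_lintegral_of_dominated_convergence' (fun t => Φ t ‖w.toL0 t‖ₑ)
      (fun n => h.aemeasurable_enorm _) (fun n => ?_) hw ?_
    · filter_upwards [h.monotone, hy n] with t h1 h2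
      apply h1
      rw [← ofReal_norm, ← ofReal_norm]
      exact ENNReal.ofReal_le_ofReal h2
    · filter_upwards [h.tendsto_nhds_zero, hyt] with t h1 h2
      refine h1.comp ?_
      simpa using h2.enorm
  -- Using `‖y‖ ≤ 1 + I_Φ(y)` makes the factor of `‖f‖` tend to `1`, whatever the norm of `w`.
  have hbd : ∀ n, |f w| ≤ e + ‖f‖ * (1 + (modular Φ μ (y n).toL0).toReal) := by
    intro n
    have hyn : modular Φ μ (y n).toL0 ≠ ∞ := ne_top_of_le_ne_top hw (h.modular_le_of_abs_le (hy n))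
    have h1 : |f (p n)| ≤ e := hpe n _ (Eventually.of_forall fun t => le_rfl)
    have h2 : |f (y n)| ≤ ‖f‖ * ‖y n‖ := f.le_opNorm (y n)
    have h3 := mul_le_mul_of_nonneg_left (OrliczSpace.norm_le_one_add_modular (y n) hyn)
      (norm_nonneg f)
    calc |f w| = |f (p n) + f (y n)| := by rw [← map_add, ← hpy n]
      _ ≤ |f (p n)| + |f (y n)| := abs_add_le _ _
      _ ≤ _ := by linarith
  have hlim' : Tendsto (fun n => e + ‖f‖ * (1 + (modular Φ μ (y n).toL0).toReal)) atTop
      (𝓝 (e + ‖f‖ * (1 + 0))) := by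
    refine ((((ENNReal.tendsto_toReal ENNReal.zero_ne_top).comp hlim).const_add 1).const_mul
      ‖f‖).const_add e
  have := ge_of_tendsto' hlim' hbd
  linarith

/-- A dual norm bound from the modular: `I_{Φ*}(v) + ‖f_s‖ ≤ 1` implies `‖f_v + f_s‖ ≤ 1`. -/
theorem norm_add_le_one {v : T →ₘ[μ] ℝ} (hv : v ∈ orliczSet (complementary Φ) μ)
    {f : StrongDual ℝ (OrliczSpace h)} (hf : IsPurelySingular f)
    (hle : modular (complementary Φ) μ v + ENNReal.ofReal ‖f‖ ≤ 1) :
    ‖ordContFunctional h v hv + f‖ ≤ 1 := by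
  refine ContinuousLinearMap.opNorm_le_bound _ zero_le_one fun w => ?_
  rw [one_mul]
  refine le_of_forall_pos_le_add fun e he => ?_
  -- After scaling by a near-minimizer, Young's inequality and the singular bound add up to `1 +
  -- I_Φ(kw)`, which is at most `k * (‖w‖ + e)`.
  obtain ⟨k, hk, h1⟩ := exists_one_add_modular_le h w.toL0_mem he
  have h2 : modular Φ μ (k • w).toL0 ≠ ∞ :=
    ne_top_of_le_ne_top ENNReal.ofReal_ne_top (le_add_self.trans h1)
  have h3 : ‖(ordContFunctional h v hv + f) (k • w)‖ₑ ≤ ENNReal.ofReal (k * (‖w‖ + e)) := by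
    calc ‖(ordContFunctional h v hv + f) (k • w)‖ₑ
        ≤ ‖ordContFunctional h v hv (k • w)‖ₑ + ‖f (k • w)‖ₑ := enorm_add_le _ _
      _ ≤ (modular Φ μ (k • w).toL0 + modular (complementary Φ) μ v) + ENNReal.ofReal ‖f‖ := by
          refine add_le_add (enorm_integral_mul_le h _ _) ?_
          rw [← ofReal_norm]
          exact ENNReal.ofReal_le_ofReal (hf.abs_apply_le_norm _ h2)
      _ ≤ 1 + modular Φ μ (k • w).toL0 := by
          rw [add_assoc, add_comm]; gcongr
      _ ≤ _ := h1
  rw [← ofReal_norm, ENNReal.ofReal_le_ofReal_iff (by positivity), map_smul, norm_smul,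
    Real.norm_of_nonneg hk.le] at h3
  exact le_of_mul_le_mul_left h3 hk

omit [SigmaFinite μ] in
/-- Replace `y` by `p` where `p` dominates `y`; the change is controlled by `p`. -/
theorem OrliczSpace.exists_glue (p y : OrliczSpace h) :
    ∃ a b : OrliczSpace h, (∀ᵐ t ∂μ, |a.toL0 t| ≤ |p.toL0 t|) ∧ (∀ᵐ t ∂μ, |b.toL0 t| ≤ |p.toL0 t|) ∧
      ∀ᵐ t ∂μ, (a + y - b).toL0 t = if |p.toL0 t| < |y.toL0 t| then y.toL0 t else p.toL0 t := by
  have hA : MeasurableSet {t | |p.toL0 t| < |y.toL0 t|} :=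
    measurableSet_lt p.toL0.measurable.abs y.toL0.measurable.abs
  obtain ⟨a, ha⟩ := OrliczSpace.exists_of_abs_le p
    (g := fun t => if |p.toL0 t| < |y.toL0 t| then 0 else p.toL0 t)
    (Measurable.ite hA measurable_const p.toL0.measurable).aestronglyMeasurable
    (Eventually.of_forall fun t => by split_ifs <;> simp)
  obtain ⟨b, hb⟩ := OrliczSpace.exists_of_abs_le p
    (g := fun t => if |p.toL0 t| < |y.toL0 t| then 0 else y.toL0 t)
    (Measurable.ite hA measurable_const y.toL0.measurable).aestronglyMeasurable
    (Eventually.of_forall fun t => by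
      split_ifs with h
      · simp
      · exact not_lt.1 h)
  refine ⟨a, b, ?_, ?_, ?_⟩
  · filter_upwards [ha] with t h1
    rw [h1]; split_ifs <;> simp
  · filter_upwards [hb] with t h1
    rw [h1]; split_ifs with h
    · simp
    · exact not_lt.1 h
  · filter_upwards [ha, hb, AEEqFun.coeFn_add a.toL0 y.toL0,
      AEEqFun.coeFn_sub (a.toL0 + y.toL0) b.toL0] with t h1 h2 h3 h4
    rw [toL0_sub, toL0_add, h4, Pi.sub_apply, h3, Pi.add_apply, h1, h2]
    split_ifs <;> ring

/-- If `‖f_v + f_s‖ ≤ 1` then `∫ x v + ‖f_s‖ ≤ 1 + I_Φ(x)` on the domain of the modular. -/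
theorem integral_mul_add_norm_le {v : T →ₘ[μ] ℝ} (hv : v ∈ orliczSet (complementary Φ) μ)
    {f : StrongDual ℝ (OrliczSpace h)} (hf : IsPurelySingular f)
    (hle : ‖ordContFunctional h v hv + f‖ ≤ 1) (x : OrliczSpace h)
    (hx : modular Φ μ x.toL0 ≠ ∞) :
    ∫ t, x.toL0 t * v t ∂μ + ‖f‖ ≤ 1 + (modular Φ μ x.toL0).toReal := by
  -- One `e` is lost in replacing `x` by `P` in the integral, one in nearly norming `f` by `z`, and
  -- one for each of `q n`, `a n`, `b n`.
  suffices H : ∀ e : ℝ, 0 < e →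
      ∫ t, x.toL0 t * v t ∂μ + ‖f‖ ≤ 1 + (modular Φ μ x.toL0).toReal + 5 * e by
    refine le_of_forall_pos_le_add fun e he => ?_
    have := H (e / 5) (by positivity)
    linarith
  intro e he
  obtain ⟨p, -, -, hp, -, hpt, -, hpe⟩ := hf.exists_decomposition x he
  have hlim1 : Tendsto (fun n => ∫ t, (p n).toL0 t * v t ∂μ) atTop (𝓝 (∫ t, x.toL0 t * v t ∂μ)) := by
    refine tendsto_integral_of_dominated_convergence (fun t => ‖x.toL0 t * v t‖)
      (fun n => ((p n).toL0.measurable.mul v.measurable).aestronglyMeasurable)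
      (integrable_mul h x.toL0_mem hv).norm (fun n => ?_) ?_
    · filter_upwards [hp n] with t ht
      rw [norm_mul, norm_mul]
      gcongr
      exact ht
    · filter_upwards [hpt] with t ht using ht.mul_const _
  obtain ⟨m, hm⟩ := (hlim1.eventually (lt_mem_nhds (sub_lt_self _ he))).exists
  have hPx := h.modular_le_of_abs_le (hp m)
  have hP : modular Φ μ (p m).toL0 ≠ ∞ := ne_top_of_le_ne_top hx hPx
  have hPx' := ENNReal.toReal_mono hx hPx
  have hPe := hpe m
  set P := p m
  obtain ⟨z, hz, hfz⟩ : ∃ z : OrliczSpace h, ‖z‖ < 1 ∧ ‖f‖ - e < f z := by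
    obtain ⟨z, hz, hfz⟩ := f.exists_lt_apply_of_lt_opNorm (sub_lt_self ‖f‖ he)
    rcases le_total 0 (f z) with h0 | h0
    · exact ⟨z, hz, by rwa [Real.norm_of_nonneg h0] at hfz⟩
    · exact ⟨-z, by rwa [norm_neg], by rwa [map_neg, ← Real.norm_of_nonpos h0]⟩
  have hzt := z.modular_ne_top_of_norm_lt_one hz
  obtain ⟨q, y, hqy, -, hy, -, hyt, hqe⟩ := hf.exists_decomposition z he
  have hglue := fun n => OrliczSpace.exists_glue P (y n)
  choose a b ha hb hw using hglue
  set w : ℕ → OrliczSpace h := fun n => a n + y n - b n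
  have hw' : ∀ᵐ t ∂μ, ∀ n, (w n).toL0 t =
      if |P.toL0 t| < |(y n).toL0 t| then (y n).toL0 t else P.toL0 t := ae_all_iff.2 hw
  -- Since `y n → 0`, the glued function eventually equals `P` wherever `P ≠ 0`; where `P = 0` it is
  -- `y n` itself.
  have hwt : ∀ᵐ t ∂μ, ((∀ᶠ n in atTop, (w n).toL0 t = P.toL0 t) ∨
      (P.toL0 t = 0 ∧ Tendsto (fun n => (w n).toL0 t) atTop (𝓝 0))) := by
    filter_upwards [hw', hyt] with t h1 h2
    by_cases hP0 : P.toL0 t = 0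
    · right
      refine ⟨hP0, ?_⟩
      have : (fun n => (w n).toL0 t) = fun n => (y n).toL0 t := by
        funext n
        rw [h1 n, hP0, abs_zero]
        split_ifs with h3
        · rfl
        · exact (abs_eq_zero.1 (le_antisymm (not_lt.1 h3) (abs_nonneg _))).symm
      rw [this]; exact h2
    · left
      have h3 : Tendsto (fun n => |(y n).toL0 t|) atTop (𝓝 0) := by simpa using h2.abs
      filter_upwards [h3.eventually (gt_mem_nhds (abs_pos.2 hP0))] with n hn
      rw [h1 n, if_neg (not_lt.2 hn.le)]
  have hwle : ∀ᵐ t ∂μ, ∀ n, |(w n).toL0 t| ≤ |P.toL0 t| ∨ |(w n).toL0 t| ≤ |z.toL0 t| := by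
    filter_upwards [hw', ae_all_iff.2 hy] with t h1 h2 n
    rw [h1 n]
    split_ifs
    · exact Or.inr (h2 n)
    · exact Or.inl le_rfl
  have hlim2 : Tendsto (fun n => ∫ t, (w n).toL0 t * v t ∂μ) atTop
      (𝓝 (∫ t, P.toL0 t * v t ∂μ)) := by
    refine tendsto_integral_of_dominated_convergence
      (fun t => ‖P.toL0 t * v t‖ + ‖z.toL0 t * v t‖)
      (fun n => ((w n).toL0.measurable.mul v.measurable).aestronglyMeasurable)
      ((integrable_mul h P.toL0_mem hv).norm.add (integrable_mul h z.toL0_mem hv).norm)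
      (fun n => ?_) ?_
    · filter_upwards [hwle] with t ht
      rw [norm_mul, norm_mul, norm_mul, ← add_mul]
      gcongr
      rcases ht n with h1 | h1
      · exact h1.trans (le_add_of_nonneg_right (norm_nonneg _))
      · exact h1.trans (le_add_of_nonneg_left (norm_nonneg _))
    · filter_upwards [hwt] with t ht
      rcases ht with h1 | ⟨h1, h2⟩
      · exact tendsto_const_nhds.congr' (h1.mono fun n hn => by simp only [hn])
      · rw [h1]; exact h2.mul_const _
  have hlim3 : Tendsto (fun n => modular Φ μ (w n).toL0) atTop (𝓝 (modular Φ μ P.toL0)) := by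
    refine tendsto_lintegral_of_dominated_convergence'
      (fun t => Φ t ‖P.toL0 t‖ₑ + Φ t ‖z.toL0 t‖ₑ)
      (fun n => h.aemeasurable_enorm _) (fun n => ?_) ?_ ?_
    · filter_upwards [hwle, h.monotone] with t h1 h2
      rcases h1 n with h3 | h3
      · refine (h2 ?_).trans le_self_add
        rw [← ofReal_norm, ← ofReal_norm]
        exact ENNReal.ofReal_le_ofReal h3
      · refine (h2 ?_).trans le_add_self
        rw [← ofReal_norm, ← ofReal_norm]
        exact ENNReal.ofReal_le_ofReal h3
    · rw [lintegral_add_left' (h.aemeasurable_enorm _)]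
      exact ENNReal.add_ne_top.2 ⟨hP, hzt⟩
    · filter_upwards [hwt, h.tendsto_nhds_zero, h.zero] with t h1 h2 h3
      rcases h1 with h1 | ⟨h1, h4⟩
      · exact tendsto_const_nhds.congr' (h1.mono fun n hn => by simp only [hn])
      · rw [h1, enorm_zero, h3]
        refine h2.comp ?_
        simpa using h4.enorm
  have hwfin : ∀ᶠ n in atTop, modular Φ μ (w n).toL0 < ∞ :=
    hlim3.eventually (gt_mem_nhds hP.lt_top)
  -- `w n` differs from `y n` by pieces dominated by `P`, and `y n` from `z` by `q n`. As `f` is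
  -- small on all of these, `f (w n)` stays near `‖f‖`, while the integral and the modular of `w n`
  -- approach those of `P`.
  have hbd : ∀ᶠ n in atTop, ∫ t, (w n).toL0 t * v t ∂μ + (‖f‖ - 4 * e) ≤
      1 + (modular Φ μ (w n).toL0).toReal := by
    filter_upwards [hwfin] with n hn
    have h1 := (w n).norm_le_one_add_modular hn.ne
    have h2 : (ordContFunctional h v hv + f) (w n) ≤ ‖w n‖ :=
      (le_abs_self _).trans (((ordContFunctional h v hv + f).le_opNorm (w n)).trans
        (mul_le_of_le_one_left (norm_nonneg _) hle))
    rw [add_apply, ordContFunctional_apply] at h2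
    have h3 : f (w n) = f (a n) + f (y n) - f (b n) := by rw [map_sub, map_add]
    have h4 : f z = f (q n) + f (y n) := by rw [← map_add, ← hqy n]
    have h5 := abs_le.1 (hPe _ (ha n))
    have h6 := abs_le.1 (hPe _ (hb n))
    have h7 := abs_le.1 (hqe n (q n) (Eventually.of_forall fun t => le_rfl))
    linarith [h5.1, h6.2, h7.2]
  have hfinal := le_of_tendsto_of_tendsto (hlim2.add_const (‖f‖ - 4 * e))
    (((ENNReal.tendsto_toReal hP).comp hlim3).const_add 1) hbd
  linarith

/-- The norm of a functional controls the modular of its order continuous part together with the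
norm of its singular part. -/
theorem modular_add_norm_le_one {v : T →ₘ[μ] ℝ} (hv : v ∈ orliczSet (complementary Φ) μ)
    {f : StrongDual ℝ (OrliczSpace h)} (hf : IsPurelySingular f)
    (hle : ‖ordContFunctional h v hv + f‖ ≤ 1) :
    modular (complementary Φ) μ v + ENNReal.ofReal ‖f‖ ≤ 1 := by
  have hf1 : ENNReal.ofReal ‖f‖ ≤ 1 := by
    have h0 : modular Φ μ (0 : OrliczSpace h).toL0 = 0 := by
      rw [modular, ← lintegral_zero (μ := μ)]
      refine lintegral_congr_ae ?_
      filter_upwards [h.zero, AEEqFun.coeFn_zero (μ := μ) (β := ℝ)] with t h1 h2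
      have : (0 : OrliczSpace h).toL0 t = 0 := h2
      rw [this, enorm_zero, h1]
    have h1 := integral_mul_add_norm_le hv hf hle 0 (by rw [h0]; exact ENNReal.zero_ne_top)
    rw [h0, ← ordContFunctional_apply hv, map_zero] at h1
    rw [ENNReal.ofReal_le_one]
    simpa using h1
  -- Knowing `‖f‖ ≤ 1` from the case `x = 0`, it remains to show `I_{Φ*}(v) ≤ 1 - ‖f‖`.
  rw [← tsub_add_cancel_of_le hf1]
  gcongr
  refine ENNReal.le_of_forall_nnreal_lt fun c hc => ?_
  have hsup : modular (complementary Φ) μ v = ∫⁻ t, ⨆ n, (‖v t‖ₑ * nnrealSeq n -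
      Φ t (nnrealSeq n)) ∂μ := by
    refine lintegral_congr_ae ?_
    filter_upwards [h.monotone, h.top] with t h1 h2
    rw [complementary_eq_iSup_nnrealSeq h1 h2 enorm_ne_top]
    simp only [mul_comm]
  rw [hsup] at hc
  -- A near-maximiser of `∫ (|v| y - Φ(y))`; with the sign of `v` it becomes the test function `x`.
  -- Finiteness of `∫ Φ(y)` permits its cancellation at the end.
  obtain ⟨y, hy, hyt, hyc⟩ := exists_selection_of_lt_lintegral (Ψ := Φ)
    (fun n => h.measurable _) h.zero v.measurable.enorm hc
  have hyle : ∀ t, ‖Real.sign (v t) * (y t : ℝ)‖ₑ ≤ y t := by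
    intro t
    rw [enorm_mul]
    have h1 : ‖Real.sign (v t)‖ₑ ≤ 1 := by
      rw [← ofReal_norm, ← ENNReal.ofReal_one]
      exact ENNReal.ofReal_le_ofReal (abs_realSign_le_one _)
    have h2 : ‖(y t : ℝ)‖ₑ = y t := by
      rw [← ofReal_norm, Real.norm_of_nonneg (NNReal.coe_nonneg _)]; simp
    rw [h2]
    exact mul_le_of_le_one_left zero_le h1
  have hXm : ∫⁻ t, Φ t ‖Real.sign (v t) * (y t : ℝ)‖ₑ ∂μ ≤ ∫⁻ t, Φ t (y t) ∂μ :=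
    lintegral_mono_ae (h.monotone.mono fun t ht => ht (hyle t))
  obtain ⟨x, hx⟩ := OrliczSpace.exists_of_modular (h := h)
    ((measurable_realSign.comp v.measurable).mul hy.coe_nnreal_real).aestronglyMeasurable
    (ne_top_of_le_ne_top hyt hXm)
  have hxy : modular Φ μ x.toL0 ≤ ∫⁻ t, Φ t (y t) ∂μ := by
    refine le_trans (le_of_eq (lintegral_congr_ae ?_)) hXm
    filter_upwards [hx] with t ht
    rw [ht]; rfl
  have hxfin := ne_top_of_le_ne_top hyt hxy
  have hxv : ∀ᵐ t ∂μ, x.toL0 t * v t = |v t| * y t := by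
    filter_upwards [hx] with t ht
    rw [ht, Pi.mul_apply, Function.comp_apply, ← mul_realSign_self]; ring
  have hint := (integrable_mul h x.toL0_mem hv).congr hxv
  have h1 := integral_mul_add_norm_le hv hf hle x hxfin
  have h2 : ∫⁻ t, ‖v t‖ₑ * y t ∂μ = ENNReal.ofReal (∫ t, x.toL0 t * v t ∂μ) := by
    rw [integral_congr_ae hxv, ofReal_integral_eq_lintegral_ofReal hint
      (Eventually.of_forall fun t => by positivity)]
    refine lintegral_congr fun t => ?_
    rw [ENNReal.ofReal_mul (abs_nonneg _), ← Real.norm_eq_abs, ofReal_norm]; simp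
  have h3 : 0 ≤ ∫ t, x.toL0 t * v t ∂μ := by
    rw [integral_congr_ae hxv]
    exact integral_nonneg fun t => by positivity
  refine ENNReal.le_sub_of_add_le_right ENNReal.ofReal_ne_top ?_
  have h4 : (c + ENNReal.ofReal ‖f‖) + ∫⁻ t, Φ t (y t) ∂μ ≤ 1 + ∫⁻ t, Φ t (y t) ∂μ := by
    calc (c + ENNReal.ofReal ‖f‖) + ∫⁻ t, Φ t (y t) ∂μ
        = (c + ∫⁻ t, Φ t (y t) ∂μ) + ENNReal.ofReal ‖f‖ := by ring
      _ ≤ ENNReal.ofReal (∫ t, x.toL0 t * v t ∂μ) + ENNReal.ofReal ‖f‖ := by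
          rw [← h2]; gcongr
      _ = ENNReal.ofReal (∫ t, x.toL0 t * v t ∂μ + ‖f‖) :=
          (ENNReal.ofReal_add h3 (norm_nonneg _)).symm
      _ ≤ ENNReal.ofReal (1 + (modular Φ μ x.toL0).toReal) := ENNReal.ofReal_le_ofReal h1
      _ = 1 + modular Φ μ x.toL0 := by
          rw [ENNReal.ofReal_add zero_le_one ENNReal.toReal_nonneg, ENNReal.ofReal_one,
            ENNReal.ofReal_toReal hxfin]
      _ ≤ _ := by gcongr
  exact (ENNReal.add_le_add_iff_right hyt).1 h4

end Dual

end MusielakOrlicz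

/-! ### Equality in Young's inequality and support functionals. -/

namespace MusielakOrlicz

/-- The product form is what equality in Young's inequality delivers, and it is invariant under
scaling by `k > 0`. -/
theorem realSign_eq_iff (a b : ℝ) :
    (a ≠ 0 → b ≠ 0 → Real.sign b = Real.sign a) ↔ 0 ≤ a * b := by
  rcases lt_trichotomy a 0 with ha | rfl | ha <;> rcases lt_trichotomy b 0 with hb | rfl | hb
  · simp [Real.sign_of_neg, ha, hb, (mul_pos_of_neg_of_neg ha hb).le]
  · simp
  · have h1 : ¬ 0 ≤ a * b := not_le.2 (mul_neg_of_neg_of_pos ha hb)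
    simp [Real.sign_of_neg ha, Real.sign_of_pos hb, h1, ha.ne, hb.ne']; norm_num
  · simp
  · simp
  · simp
  · have h1 : ¬ 0 ≤ a * b := not_le.2 (mul_neg_of_pos_of_neg ha hb)
    simp [Real.sign_of_pos ha, Real.sign_of_neg hb, h1, ha.ne', hb.ne]; norm_num
  · simp
  · simp [Real.sign_of_pos, ha, hb, (mul_pos ha hb).le]

variable {T : Type*} [MeasurableSpace T] {Φ : T → ℝ≥0∞ → ℝ≥0∞} {μ : Measure T}

theorem mul_le_toReal_add_toReal {t : T} {a b : ℝ} (ha : Φ t ‖a‖ₑ ≠ ∞)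
    (hb : complementary Φ t ‖b‖ₑ ≠ ∞) :
    |a| * |b| ≤ (Φ t ‖a‖ₑ).toReal + (complementary Φ t ‖b‖ₑ).toReal := by
  have h1 := ENNReal.toReal_mono (by finiteness) (young Φ t ‖a‖ₑ ‖b‖ₑ)
  rwa [ENNReal.toReal_add ha hb, ENNReal.toReal_mul, toReal_enorm, toReal_enorm,
    Real.norm_eq_abs, Real.norm_eq_abs] at h1

/-- Equality in the signed Young inequality. -/
theorem mul_eq_toReal_add_toReal_iff {t : T} (hc : ConvexOn ℝ≥0 univ (Φ t)) (h0 : Φ t 0 = 0)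
    (ht : Φ t ∞ = ∞) {a b : ℝ} (ha : Φ t ‖a‖ₑ ≠ ∞) (hb : complementary Φ t ‖b‖ₑ ≠ ∞) :
    a * b = (Φ t ‖a‖ₑ).toReal + (complementary Φ t ‖b‖ₑ).toReal ↔
      0 ≤ a * b ∧ ‖b‖ₑ ∈ subdiff (Φ t) ‖a‖ₑ := by
  have h1 : ‖b‖ₑ ∈ subdiff (Φ t) ‖a‖ₑ ↔ Φ t ‖a‖ₑ + complementary Φ t ‖b‖ₑ = ‖a‖ₑ * ‖b‖ₑ :=
    mem_subdiff_iff (x := ‖a‖₊) (y := ‖b‖₊) hc h0 ht ha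
  rw [h1, ← ENNReal.toReal_eq_toReal_iff' (by finiteness) (by finiteness),
    ENNReal.toReal_add ha hb, ENNReal.toReal_mul, toReal_enorm, toReal_enorm, Real.norm_eq_abs,
    Real.norm_eq_abs]
  have h2 := mul_le_toReal_add_toReal ha hb
  have h3 : a * b ≤ |a| * |b| := by rw [← abs_mul]; exact le_abs_self _
  constructor
  · intro h
    have h4 : a * b = |a| * |b| := le_antisymm h3 (by rw [h]; exact h2)
    exact ⟨by rw [h4]; positivity, by rw [← h, h4]⟩
  · rintro ⟨h4, h5⟩
    rw [h5, ← abs_mul, abs_of_nonneg h4]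

theorem integral_mul_le_toReal_add_toReal (h : IsMusielakOrlicz Φ μ) {w v : T →ₘ[μ] ℝ}
    (hw : modular Φ μ w ≠ ∞) (hv : modular (complementary Φ) μ v ≠ ∞) :
    ∫ t, w t * v t ∂μ ≤ (modular Φ μ w).toReal + (modular (complementary Φ) μ v).toReal := by
  have h1 := ENNReal.toReal_mono (by finiteness) (enorm_integral_mul_le h w v)
  rw [ENNReal.toReal_add hw hv, toReal_enorm] at h1
  exact (le_abs_self _).trans h1

/-- Equality in the integrated Young inequality. -/
theorem integral_mul_eq_iff (h : IsMusielakOrlicz Φ μ) {w v : T →ₘ[μ] ℝ}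
    (hw : modular Φ μ w ≠ ∞) (hv : modular (complementary Φ) μ v ≠ ∞) :
    ∫ t, w t * v t ∂μ = (modular Φ μ w).toReal + (modular (complementary Φ) μ v).toReal ↔
      ∀ᵐ t ∂μ, 0 ≤ w t * v t ∧ ‖v t‖ₑ ∈ subdiff (Φ t) ‖w t‖ₑ := by
  have hΦm := h.aemeasurable_enorm w
  have hΨm : AEMeasurable (fun t => complementary Φ t ‖v t‖ₑ) μ :=
    h.aemeasurable_complementary v.aestronglyMeasurable.enorm fun t => enorm_ne_top
  have hΦ := ae_lt_top' hΦm hw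
  have hΨ := ae_lt_top' hΨm hv
  have hΦi := integrable_toReal_of_lintegral_ne_top hΦm hw
  have hΨi := integrable_toReal_of_lintegral_ne_top hΨm hv
  have hwv : Integrable (fun t => w t * v t) μ :=
    integrable_mul h ⟨1, one_pos, by rw [one_smul]; exact hw.lt_top⟩
      ⟨1, one_pos, by rw [one_smul]; exact hv.lt_top⟩
  have hsum : (modular Φ μ w).toReal + (modular (complementary Φ) μ v).toReal =
      ∫ t, ((Φ t ‖w t‖ₑ).toReal + (complementary Φ t ‖v t‖ₑ).toReal) ∂μ := by
    rw [integral_add hΦi hΨi, integral_toReal hΦm hΦ, integral_toReal hΨm hΨ]; rfl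
  have hadd : Integrable (fun t => (Φ t ‖w t‖ₑ).toReal + (complementary Φ t ‖v t‖ₑ).toReal) μ :=
    hΦi.add hΨi
  -- The Young deficit is nonnegative, so its integral vanishes exactly when it is zero almost
  -- everywhere.
  have hnn : 0 ≤ᵐ[μ] fun t =>
      (Φ t ‖w t‖ₑ).toReal + (complementary Φ t ‖v t‖ₑ).toReal - w t * v t := by
    filter_upwards [hΦ, hΨ] with t h1 h2
    have h3 := mul_le_toReal_add_toReal h1.ne h2.ne
    rw [← abs_mul] at h3
    exact sub_nonneg.2 ((le_abs_self _).trans h3)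
  rw [hsum, eq_comm, ← sub_eq_zero, ← integral_sub hadd hwv,
    integral_eq_zero_iff_of_nonneg_ae hnn (hadd.sub hwv)]
  refine eventually_congr ?_
  filter_upwards [hΦ, hΨ, h.convex, h.zero, h.top] with t h1 h2 h3 h4 h5
  rw [← mul_eq_toReal_add_toReal_iff h3 h4 h5 h1.ne h2.ne, Pi.zero_apply, sub_eq_zero, eq_comm]

section Main

variable {h : IsMusielakOrlicz Φ μ} [SigmaFinite μ]

/-- The infimum of Amemiya's expression is the norm, and at a minimizer it is attained without
error. In particular `I_Φ(ku)` is finite. -/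
theorem one_add_modular_eq_of_mem_minimizers {u : OrliczSpace h} {k : ℝ} (hk : k ∈ minimizers u) :
    1 + modular Φ μ (k • u).toL0 = ENNReal.ofReal (k * ‖u‖) := by
  obtain ⟨hk0, hkm⟩ := hk
  refine le_antisymm ?_ (ofReal_mul_orliczNorm_le h u.toL0 hk0)
  have h1 : amemiya u k ≤ ENNReal.ofReal ‖u‖ := by
    refine ENNReal.le_of_forall_pos_le_add fun e he _ => ?_
    obtain ⟨l, hl, h2⟩ := exists_one_add_modular_le h u.toL0_mem (NNReal.coe_pos.2 he)
    have hl0 : ENNReal.ofReal l ≠ 0 := by simpa using hl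
    calc amemiya u k ≤ amemiya u l := by rw [hkm]; exact iInf₂_le l hl
      _ ≤ (ENNReal.ofReal l)⁻¹ * ENNReal.ofReal (l * (‖u‖ + e)) := by
          unfold amemiya; gcongr; exact h2
      _ = ENNReal.ofReal ‖u‖ + e := by
          rw [ENNReal.ofReal_mul hl.le, ← mul_assoc,
            ENNReal.inv_mul_cancel hl0 ENNReal.ofReal_ne_top, one_mul,
            ENNReal.ofReal_add (norm_nonneg _) e.coe_nonneg, ENNReal.ofReal_coe_nnreal]
  have hk' : ENNReal.ofReal k ≠ 0 := by simpa using hk0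
  calc 1 + modular Φ μ (k • u).toL0 = ENNReal.ofReal k * amemiya u k := by
        rw [amemiya, ← mul_assoc, ENNReal.mul_inv_cancel hk' ENNReal.ofReal_ne_top, one_mul]; rfl
    _ ≤ ENNReal.ofReal k * ENNReal.ofReal ‖u‖ := by gcongr
    _ = _ := (ENNReal.ofReal_mul hk0.le).symm

/-- Support functionals at `u`, described with a fixed minimizer of Amemiya's expression. -/
theorem isSupportFunctional_iff {u : OrliczSpace h} (hu : u ≠ 0) {k : ℝ} (hk : k ∈ minimizers u)
    {fs : StrongDual ℝ (OrliczSpace h)} {v : T →ₘ[μ] ℝ}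
    (hv : v ∈ orliczSet (complementary Φ) μ) (hfs : IsPurelySingular fs) :
    IsSupportFunctional (ordContFunctional h v hv + fs) u ↔
      modular (complementary Φ) μ v + ENNReal.ofReal ‖fs‖ = 1 ∧ ‖fs‖ = fs (k • u) ∧
        ∀ᵐ t ∂μ, 0 ≤ (k • u).toL0 t * v t ∧ ‖v t‖ₑ ∈ subdiff (Φ t) ‖(k • u).toL0 t‖ₑ := by
  have hk0 : 0 < k := hk.1
  have hmod := one_add_modular_eq_of_mem_minimizers hk
  have hfin : modular Φ μ (k • u).toL0 ≠ ∞ :=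
    ne_top_of_le_ne_top ENNReal.ofReal_ne_top (le_add_self.trans hmod.le)
  have hmod' : 1 + (modular Φ μ (k • u).toL0).toReal = k * ‖u‖ := by
    have := congrArg ENNReal.toReal hmod
    rwa [ENNReal.toReal_add ENNReal.one_ne_top hfin, ENNReal.toReal_one,
      ENNReal.toReal_ofReal (by positivity)] at this
  have happly : k * (ordContFunctional h v hv + fs) u =
      ∫ t, (k • u).toL0 t * v t ∂μ + fs (k • u) := by
    rw [← ordContFunctional_apply hv, ← add_apply, map_smul, smul_eq_mul]
  have hs : fs (k • u) ≤ ‖fs‖ := (le_abs_self _).trans (hfs.abs_apply_le_norm _ hfin)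
  constructor
  · rintro ⟨hn, hfu⟩
    have hB := modular_add_norm_le_one hv hfs hn.le
    have hvfin : modular (complementary Φ) μ v ≠ ∞ :=
      ne_top_of_le_ne_top ENNReal.one_ne_top (le_self_add.trans hB)
    have hB' := ENNReal.toReal_mono ENNReal.one_ne_top hB
    rw [ENNReal.toReal_add hvfin ENNReal.ofReal_ne_top, ENNReal.toReal_ofReal (norm_nonneg _),
      ENNReal.toReal_one] at hB'
    have hY := integral_mul_le_toReal_add_toReal h hfin hvfin
    rw [hfu] at happly
    -- `hY`, `hs` and `hB'` add up to `k‖u‖ ≤ 1 + I_Φ(ku)`, which is an equality by `hmod'`; hence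
    -- each of them is an equality.
    refine ⟨?_, by linarith, (integral_mul_eq_iff h hfin hvfin).1 (by linarith)⟩
    rw [← ENNReal.ofReal_toReal hvfin, ← ENNReal.ofReal_add ENNReal.toReal_nonneg (norm_nonneg _),
      ENNReal.ofReal_eq_one]
    linarith
  · rintro ⟨h1, h2, h3⟩
    have hvfin : modular (complementary Φ) μ v ≠ ∞ :=
      ne_top_of_le_ne_top ENNReal.one_ne_top (le_self_add.trans h1.le)
    have hle := norm_add_le_one hv hfs h1.le
    have h1' := congrArg ENNReal.toReal h1
    rw [ENNReal.toReal_add hvfin ENNReal.ofReal_ne_top, ENNReal.toReal_ofReal (norm_nonneg _),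
      ENNReal.toReal_one] at h1'
    rw [(integral_mul_eq_iff h hfin hvfin).2 h3, ← h2] at happly
    have hfu : (ordContFunctional h v hv + fs) u = ‖u‖ :=
      mul_left_cancel₀ hk0.ne' (by linarith)
    refine ⟨le_antisymm hle ?_, hfu⟩
    have h4 := (le_abs_self _).trans ((ordContFunctional h v hv + fs).le_opNorm u)
    rw [hfu] at h4
    exact le_of_mul_le_mul_right (by rwa [one_mul]) (norm_pos_iff.2 hu)

omit [SigmaFinite μ] in
theorem ae_sign_and_mem_subdiff_iff (u : OrliczSpace h) (v : T →ₘ[μ] ℝ) {k : ℝ} (hk : 0 < k) :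
    (∀ᵐ t ∂μ, 0 ≤ (k • u).toL0 t * v t ∧ ‖v t‖ₑ ∈ subdiff (Φ t) ‖(k • u).toL0 t‖ₑ) ↔
      ∀ᵐ t ∂μ, (u.toL0 t ≠ 0 → v t ≠ 0 → Real.sign (v t) = Real.sign (u.toL0 t)) ∧
        ENNReal.ofReal |v t| ∈ subdiff (Φ t) (ENNReal.ofReal |k * u.toL0 t|) := by
  refine eventually_congr ?_
  filter_upwards [AEEqFun.coeFn_smul k u.toL0] with t ht
  rw [OrliczSpace.toL0_smul, ht, Pi.smul_apply, smul_eq_mul, realSign_eq_iff, mul_assoc,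
    mul_nonneg_iff_of_pos_left hk, ← ofReal_norm, ← ofReal_norm, Real.norm_eq_abs, Real.norm_eq_abs]

omit [MeasurableSpace T] in
/-- For strictly positive `φ` with `φ'₊(0) = 0` the subdifferential determines where `v`
vanishes. -/
theorem sign_eq_of_mem_subdiff {φ : ℝ≥0∞ → ℝ≥0∞} (hc : ConvexOn ℝ≥0 univ φ) (h0 : φ 0 = 0)
    (ht : φ ∞ = ∞) (hpos : ∀ x, 0 < x → 0 < φ x) (hr : rightDeriv φ 0 = 0) {k a b : ℝ}
    (hk : 0 < k) (hs : a ≠ 0 → b ≠ 0 → Real.sign b = Real.sign a)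
    (hb : ENNReal.ofReal |b| ∈ subdiff φ (ENNReal.ofReal |k * a|)) :
    Real.sign b = Real.sign a := by
  -- At `a = 0` the vanishing right derivative forces `b = 0`.
  rcases eq_or_ne a 0 with rfl | ha
  · have h1 := hb.2
    rw [mul_zero, abs_zero, ENNReal.ofReal_zero, hr] at h1
    have h2 : b = 0 := by simpa using h1
    rw [h2]
  rcases eq_or_ne b 0 with rfl | hb0
  -- Here `b = 0` would make the left derivative zero at `k|a| > 0`, yet it dominates the slope of
  -- the chord from the origin, which is positive.
  · exfalso
    have hka : 0 < |k * a| := abs_pos.2 (mul_ne_zero hk.ne' ha)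
    have hx : 0 < φ (ENNReal.ofReal |k * a|) := hpos _ (ENNReal.ofReal_pos.2 hka)
    have h1 := hb.1
    rw [abs_zero, ENNReal.ofReal_zero, nonpos_iff_eq_zero] at h1
    by_cases htop : φ (ENNReal.ofReal |k * a|) = ∞
    · rw [leftDeriv, if_pos htop] at h1
      exact ENNReal.top_ne_zero h1
    have h2 := div_le_leftDeriv (x := Real.toNNReal |k * a|) (z := 0) hc
      (monotone_of_convex hc h0 ht) htop (Real.toNNReal_pos.2 hka)
    change _ ≤ leftDeriv φ (ENNReal.ofReal |k * a|) at h2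
    rw [h1, nonpos_iff_eq_zero, ENNReal.div_eq_zero_iff] at h2
    rcases h2 with h2 | h2
    · rw [ENNReal.coe_zero, h0, tsub_zero] at h2
      exact hx.ne' h2
    · simp at h2
  · exact hs ha hb0

end Main

end MusielakOrlicz

theorem mainTheorem4 {T : Type*} [MeasurableSpace T] (μ : MeasureTheory.Measure T)
    [MeasureTheory.SigmaFinite μ] (hμ : MusielakOrlicz.IsNonatomic μ)
    (Φ : T → ℝ≥0∞ → ℝ≥0∞) (hΦ : MusielakOrlicz.IsMusielakOrlicz Φ μ)
    (u : MusielakOrlicz.OrliczSpace hΦ) (hu : u ≠ 0)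
    (hK : (MusielakOrlicz.minimizers u).Nonempty)
    (f fs : StrongDual ℝ (MusielakOrlicz.OrliczSpace hΦ))
    (v : T →ₘ[μ] ℝ)
    (hv : v ∈ MusielakOrlicz.orliczSet (MusielakOrlicz.complementary Φ) μ)
    (hfs : MusielakOrlicz.IsPurelySingular fs)
    (hf : f = MusielakOrlicz.ordContFunctional hΦ v hv + fs) :
    (MusielakOrlicz.IsSupportFunctional f u ↔
      ∀ k ∈ MusielakOrlicz.minimizers u,
        MusielakOrlicz.modular (MusielakOrlicz.complementary Φ) μ v
            + ENNReal.ofReal ‖fs‖ = 1 ∧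
        ‖fs‖ = fs (k • u) ∧
        ∀ᵐ t ∂μ, (u.toL0 t ≠ 0 → v t ≠ 0 → Real.sign (v t) = Real.sign (u.toL0 t)) ∧
          ENNReal.ofReal |v t| ∈
            MusielakOrlicz.subdiff (Φ t) (ENNReal.ofReal |k * u.toL0 t|)) ∧
    ((∀ᵐ t ∂μ, (∀ x, 0 < x → 0 < Φ t x) ∧ MusielakOrlicz.rightDeriv (Φ t) 0 = 0) →
      (MusielakOrlicz.IsSupportFunctional f u ↔
        ∀ k ∈ MusielakOrlicz.minimizers u,
          MusielakOrlicz.modular (MusielakOrlicz.complementary Φ) μ v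
              + ENNReal.ofReal ‖fs‖ = 1 ∧
          ‖fs‖ = fs (k • u) ∧
          ∀ᵐ t ∂μ, Real.sign (v t) = Real.sign (u.toL0 t) ∧
            ENNReal.ofReal |v t| ∈
              MusielakOrlicz.subdiff (Φ t) (ENNReal.ofReal |k * u.toL0 t|))) := by
  subst hf
  obtain ⟨k₀, hk₀⟩ := hK
  have key : MusielakOrlicz.IsSupportFunctional (MusielakOrlicz.ordContFunctional hΦ v hv + fs) u ↔
      ∀ k ∈ MusielakOrlicz.minimizers u,
        MusielakOrlicz.modular (MusielakOrlicz.complementary Φ) μ v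
            + ENNReal.ofReal ‖fs‖ = 1 ∧
        ‖fs‖ = fs (k • u) ∧
        ∀ᵐ t ∂μ, (u.toL0 t ≠ 0 → v t ≠ 0 → Real.sign (v t) = Real.sign (u.toL0 t)) ∧
          ENNReal.ofReal |v t| ∈
            MusielakOrlicz.subdiff (Φ t) (ENNReal.ofReal |k * u.toL0 t|) := by
    constructor
    · intro H k hk
      rw [← MusielakOrlicz.ae_sign_and_mem_subdiff_iff u v hk.1]
      exact (MusielakOrlicz.isSupportFunctional_iff hu hk hv hfs).1 H
    · intro H
      -- A single minimizer suffices in this direction.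
      have H₀ := H k₀ hk₀
      rw [← MusielakOrlicz.ae_sign_and_mem_subdiff_iff u v hk₀.1] at H₀
      exact (MusielakOrlicz.isSupportFunctional_iff hu hk₀ hv hfs).2 H₀
  refine ⟨key, fun hpos => ?_⟩
  rw [key]
  refine forall₂_congr fun k hk => and_congr_right fun _ => and_congr_right fun _ => ?_
  refine eventually_congr ?_
  filter_upwards [hpos, hΦ.convex, hΦ.zero, hΦ.top] with t h1 h2 h3 h4
  exact ⟨fun H => ⟨MusielakOrlicz.sign_eq_of_mem_subdiff h2 h3 h4 h1.1 h1.2 hk.1 H.1 H.2, H.2⟩,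
    fun H => ⟨fun _ _ => H.1, H.2⟩⟩
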